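/- Let $\Sigma$ be a finite signed graph (loops and multiple edges allowed) with vertex set $V$, edge set $E$ and signs $\operatorname{sgn}:E\to\{+1,-1\}$. A coloring $\kappa:V\to\mathbb Z$ is proper if $\kappa(u)\ne\operatorname{sgn}(e)\,\kappa(v)$ for every edge $e$ with endpoints $u,v$, and the chromatic $B$-symmetric function of $\Sigma$ is the formal power series $X_\Sigma=\sum_{\kappa\text{ proper}}\ \prod_{v\in V}x_{\kappa(v)}$ in the variables $x_i$, $i\in\mathbb Z$. An orientation of $\Sigma$ assigns to each half-edge an arrow pointing toward or away from its vertex, such that on a positive edge exactly one of the two arrows points toward its vertex, and on a negative edge both or neither do. It is acyclic if there is no closed walk (with at least one edge) such that every vertex of the walk has, among the arrows on the edges of the walk, at least one pointing toward it and at least one pointing away from it. A vertex is a sink if all arrows at it point toward it (in particular, isolated vertices are sinks). For $a\ge1$, $b\ge0$ let $p_{a,b}=\sum_{i\in\mathbb Z}x_i^a x_{-i}^b$; for $a,b\ge1$ let $q_{a,b}=(-1)^{a+b+1}p_{a,b}$ (so $q_{a,b}=q_{b,a}$); let $z=-x_0$; and for $n\ge1$ let $\xi_n=\sum_{a=1}^n\binom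 na p_{a,0}$. **Theorem 3.4.** $X_\Sigma$ can be written in exactly one way as a polynomial with rational coefficients in the elements of $\{\xi_n : n\ge1\}\cup\{q_{a,b} : a\ge b\ge1\}\cup\{z\}$. For every $k\ge0$, the number of acyclic orientations of $\Sigma$ with exactly $k$ sinks equals the sum of the coefficients, in this expression, of the monomials in which the indices of the factors $\xi_n$, counted with multiplicity, sum to $k$. -/

import Mathlib

open scoped BigOperators

/-- A signed graph with vertex set `V` and edge set `E`; loops and multiple edges are allowed.
The edge `e` has two half-edges `(e, false)` and `(e, true)`, and the half-edge `(e, s)` is attached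
to the vertex `ends e s`.  The sign of `e` is `sgn e ∈ {1, -1}`. -/
structure SignedGraph (V E : Type*) where
  ends : E → Bool → V
  sgn : E → ℤˣ

namespace SignedGraph

variable {V E : Type*}

/-- A coloring by integers is proper if `κ u ≠ sgn e * κ v` for every edge `e : uv`. -/
def IsProper (G : SignedGraph V E) (κ : V → ℤ) : Prop :=
  ∀ e, κ (G.ends e false) ≠ (G.sgn e : ℤ) * κ (G.ends e true)

/-- An orientation assigns an arrow to each half-edge: `τ e s = true` says that the arrow on the
half-edge `(e, s)` points toward its vertex, `τ e s = false` that it points away from its vertex.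
On a positive edge both arrows point in the same direction along the edge, so exactly one of them
points toward its vertex; on a negative edge both or neither do. -/
def IsOrientation (G : SignedGraph V E) (τ : E → Bool → Bool) : Prop :=
  ∀ e, (G.sgn e = 1 → τ e false ≠ τ e true) ∧ (G.sgn e = -1 → τ e false = τ e true)

/-- A closed walk of length `n + 1`: the `i`-th step `w i = (e, s)` traverses the edge `e` from
`ends e s` to `ends e (!s)`, and each step ends where the (cyclically) next one starts.
The addition in `Fin (n + 1)` is modulo `n + 1`. -/
def IsClosedWalk (G : SignedGraph V E) {n : ℕ} (w : Fin (n + 1) → E × Bool) : Prop :=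
  ∀ i, G.ends (w i).1 (!(w i).2) = G.ends (w (i + 1)).1 (w (i + 1)).2

/-- A cycle of the orientation `τ`: a closed walk such that each vertex of the walk has at least one
arrow pointing toward it and at least one arrow pointing away from it, among the arrows on the edges
of the walk.  (A walk without edges is never a cycle, its vertex having no arrows.) -/
def IsCycle (G : SignedGraph V E) (τ : E → Bool → Bool) {n : ℕ}
    (w : Fin (n + 1) → E × Bool) : Prop :=
  G.IsClosedWalk w ∧ ∀ i, ∀ d : Bool, ∃ j, ∃ s : Bool,
    G.ends (w j).1 s = G.ends (w i).1 (w i).2 ∧ τ (w j).1 s = d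

/-- The orientation `τ` has no cycle. -/
def IsAcyclic (G : SignedGraph V E) (τ : E → Bool → Bool) : Prop :=
  ∀ (n : ℕ) (w : Fin (n + 1) → E × Bool), ¬ G.IsCycle τ w

/-- A vertex is a sink if all arrows at it point toward it (an isolated vertex is a sink). -/
def IsSink (G : SignedGraph V E) (τ : E → Bool → Bool) (v : V) : Prop :=
  ∀ e s, G.ends e s = v → τ e s = true

/-- The number of acyclic orientations of `G` with exactly `k` sinks. -/
noncomputable def acyclicCount (G : SignedGraph V E) (k : ℕ) : ℕ :=
  {τ : E → Bool → Bool |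
    G.IsOrientation τ ∧ G.IsAcyclic τ ∧ {v | G.IsSink τ v}.ncard = k}.ncard

end SignedGraph

/-- The formal sum `∑ i, x ^ (a i)` of monomials in the variables `x_j`, `j ∈ ℤ`: the coefficient
of `x ^ m` is the number of `i` with `a i = m`.  (Only used where each such number is finite.) -/
noncomputable def monomialSum {ι : Type*} (a : ι → ℤ →₀ ℕ) : MvPowerSeries ℤ ℚ :=
  fun m => (Nat.card {i // a i = m} : ℚ)

/-- The chromatic `B`-symmetric function
`X_G = ∑ κ, ∏ v, x_{κ v}`, the sum being over all proper colorings `κ : V → ℤ` of `G`. -/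
noncomputable def SignedGraph.chromaticB {V E : Type*} [Fintype V] (G : SignedGraph V E) :
    MvPowerSeries ℤ ℚ :=
  monomialSum fun κ : {κ : V → ℤ // G.IsProper κ} => ∑ v, Finsupp.single (κ.1 v) 1

/-- `p_{a,b} = ∑_{i ∈ ℤ} x_i ^ a * x_{-i} ^ b` (for `a + b ≥ 1`). -/
noncomputable def pB (a b : ℕ) : MvPowerSeries ℤ ℚ :=
  monomialSum fun i : ℤ => Finsupp.single i a + Finsupp.single (-i) b

/-- `q_{a,b} = (-1) ^ (a + b + 1) * p_{a,b}`. -/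
noncomputable def qB (a b : ℕ) : MvPowerSeries ℤ ℚ := (-1) ^ (a + b + 1) * pB a b

/-- `z = -x_0`. -/
noncomputable def zB : MvPowerSeries ℤ ℚ := -MvPowerSeries.X 0

/-- `ξ_n = ∑_{a=1}^n (n choose a) p_{a,0}`. -/
noncomputable def xiB (n : ℕ) : MvPowerSeries ℤ ℚ :=
  ∑ a ∈ Finset.Icc 1 n, (n.choose a : MvPowerSeries ℤ ℚ) * pB a 0

/-- `p_{a,b} = p_{b,a}`, by the substitution `i ↦ -i`. -/
theorem pB_comm (a b : ℕ) : pB a b = pB b a := by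
  funext m
  simp only [pB, monomialSum, Nat.cast_inj]
  refine Nat.card_congr ((Equiv.neg ℤ).subtypeEquiv fun i => ?_)
  simp [add_comm]

/-- `q_{a,b} = q_{b,a}`. -/
theorem qB_comm (a b : ℕ) : qB a b = qB b a := by
  rw [qB, qB, pB_comm a b, add_comm a b]

/-- Names for the elements of the set `{ξ_n | n ≥ 1} ∪ {q_{a,b} | a, b ≥ 1} ∪ {z}`.
As `q_{a,b}` and `q_{b,a}` are the same element, each is named once, with `a ≥ b ≥ 1`. -/
inductive XiIndex : Type
  | xi (n : ℕ) (hn : 1 ≤ n) : XiIndex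
  | q (a b : ℕ) (hb : 1 ≤ b) (hab : b ≤ a) : XiIndex
  | z : XiIndex

/-- The element with the given name. -/
noncomputable def xiBasis : XiIndex → MvPowerSeries ℤ ℚ
  | .xi n _ => xiB n
  | .q a b _ _ => qB a b
  | .z => zB

/-- The index of a factor `ξ_n` is `n`; the factors `q_{a,b}` and `z` do not count. -/
def XiIndex.weight : XiIndex → ℕ
  | .xi n _ => n
  | .q _ _ _ _ => 0
  | .z => 0

/-- The sum, with multiplicity, of the indices of the factors `ξ_n` of a monomial. -/
noncomputable def xiIndexSum (m : XiIndex →₀ ℕ) : ℕ := m.sum fun i c => c * i.weight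

/-!
The expansion. By inclusion and exclusion over the violated edges, the chromatic function is
`∑ S, (-1) ^ |S| Y_S`, where `S` runs over the sets of edges and `Y_S` sums over the colorings with
`κ u = sgn e * κ v` on `S`. The rational solutions of these equations form a flat, a subspace of
`V → ℚ`, and such a flat is given by a signed partition (`SignedGraph.exists_partition`): some
vertices are forced to `0`, the others fall into blocks on which `κ` is determined up to known signs
by its value at a representative. So `Y_S` is a power of `x_0` times a product of elements
`p_{a,b}`, one for each block with `a` vertices of sign `1` and `b` of sign `-1`
(`SignedPartition.monomialSum_eq`).

The number of sinks. The sum of coefficients in question is the coefficient of `X ^ k` in the image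
under the ring homomorphism `sinkWeight` with `ξ_n ↦ X ^ n`, `q_{a,b} ↦ 1`, `z ↦ 1`. It sends
`p_{a,b}` to `[b = 0] (X - 1) ^ a - (-1) ^ (a + b)`. Choosing one of the two terms for each block
means choosing a set `W` of vertices whose indicator vector is in the flat
(`SignedPartition.prod_roots_eq_sum`). For a fixed `W` the sum over `S` is then an alternating sum
over the flats of a hyperplane arrangement in `{κ | κ = 0 on W}`, and Zaslavsky's formula
(`sum_powerset_neg_one_pow_finrank`) says that it is the number of its regions. On the other side,
an orientation is acyclic exactly when some `κ` makes all its oriented edge functionals positive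
(`SignedGraph.IsOrientation.isAcyclic_iff`), and the regions above are the acyclic orientations in
which all vertices of `W` are sinks (`SignedGraph.card_acyclic_sinks`). Hence the image of the
chromatic function is the sum of `(X - 1) ^ |W|` over the pairs of an acyclic orientation and a set
`W` of sinks, which is the sum of `X ^ (number of sinks)` over the acyclic orientations.

Uniqueness. The generators are algebraically independent (`algebraicIndependent_xiBasis`): a
relation holds at their values on all finite alphabets. Adding a pair of opposite colors translates
these values by a vector that does not depend on the other colors, so a relation vanishes on
translates of an additive monoid, hence on translates of its linear span, and this span consists of
all vectors with `z`-coordinate zero, as far as finitely many generators can tell.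
-/

/-! ### Regions of hyperplane arrangements -/

section Regions

variable {M ι : Type*} [AddCommGroup M] [Module ℚ M]

/-- The set `P` is the set of those functionals `f e`, `e ∈ s`, that are positive on some region of
the arrangement of the hyperplanes `f e = 0`, `e ∈ s`, in the subspace `X`.  A functional that
vanishes on `X` leaves no region at all. -/
def IsRegion (f : ι → Module.Dual ℚ M) (X : Submodule ℚ M) (s P : Finset ι) : Prop :=
  ∃ x ∈ X, ∀ e ∈ s, (e ∈ P → 0 < f e x) ∧ (e ∉ P → f e x < 0)

open Classical in
/-- The number of regions of the arrangement of the hyperplanes `f e = 0`, `e ∈ s`, in `X`. -/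
noncomputable def regionCount (f : ι → Module.Dual ℚ M) (X : Submodule ℚ M) (s : Finset ι) : ℕ :=
  (s.powerset.filter (IsRegion f X s)).card

/-- Regions are open. -/
theorem exists_pos_perturb {f : ι → Module.Dual ℚ M} {s P : Finset ι} {x : M}
    (h : ∀ e ∈ s, (e ∈ P → 0 < f e x) ∧ (e ∉ P → f e x < 0)) (y : M) :
    ∃ δ : ℚ, 0 < δ ∧
      ∀ e ∈ s, (e ∈ P → 0 < f e (x + δ • y)) ∧ (e ∉ P → f e (x + δ • y) < 0) := by
  have key : ∀ᶠ δ in nhdsWithin (0 : ℚ) (Set.Ioi 0),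
      ∀ e ∈ s, (e ∈ P → 0 < f e (x + δ • y)) ∧ (e ∉ P → f e (x + δ • y) < 0) := by
    rw [Filter.eventually_all_finset]
    intro e he
    have hc : Filter.Tendsto (fun δ : ℚ => f e (x + δ • y)) (nhdsWithin 0 (Set.Ioi 0))
        (nhds (f e x)) := by
      have : Continuous fun δ : ℚ => f e (x + δ • y) := by
        simp only [map_add, map_smul, smul_eq_mul]; fun_prop
      have h0 := this.tendsto 0
      simp only [zero_smul, add_zero] at h0
      exact h0.mono_left nhdsWithin_le_nhds
    by_cases hP : e ∈ P
    · filter_upwards [hc.eventually (lt_mem_nhds ((h e he).1 hP))] with δ hδ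
      exact ⟨fun _ => hδ, fun h => absurd hP h⟩
    · filter_upwards [hc.eventually (gt_mem_nhds ((h e he).2 hP))] with δ hδ
      exact ⟨fun h => absurd h hP, fun _ => hδ⟩
  obtain ⟨δ, h1, h2⟩ := (key.and self_mem_nhdsWithin).exists
  exact ⟨δ, h2, h1⟩

theorem isRegion_insert_neg [DecidableEq ι] {f : ι → Module.Dual ℚ M} {X : Submodule ℚ M}
    {s P : Finset ι} {e : ι} (he : e ∉ s) (hP : P ⊆ s) :
    IsRegion f X (insert e s) P ↔
      ∃ x ∈ X, (∀ i ∈ s, (i ∈ P → 0 < f i x) ∧ (i ∉ P → f i x < 0)) ∧ f e x < 0 := by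
  have heP : e ∉ P := fun h => he (hP h)
  simp only [IsRegion, Finset.forall_mem_insert]
  refine exists_congr fun x => and_congr_right fun _ => ?_
  tauto

theorem isRegion_insert_pos [DecidableEq ι] {f : ι → Module.Dual ℚ M} {X : Submodule ℚ M}
    {s P : Finset ι} {e : ι} (he : e ∉ s) :
    IsRegion f X (insert e s) (insert e P) ↔
      ∃ x ∈ X, (∀ i ∈ s, (i ∈ P → 0 < f i x) ∧ (i ∉ P → f i x < 0)) ∧ 0 < f e x := by
  simp only [IsRegion, Finset.forall_mem_insert]
  refine exists_congr fun x => and_congr_right fun _ => ?_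
  have : ∀ i ∈ s, (i ∈ insert e P ↔ i ∈ P) := fun i hi => by
    simp [show i ≠ e from fun h => he (h ▸ hi)]
  rw [and_comm]
  refine and_congr (forall₂_congr fun i hi => by rw [this i hi]) ?_
  simp

/-- A region of the smaller arrangement is cut in two by the new hyperplane exactly when the
hyperplane meets it, and the intersection is then a region of the restriction. -/
theorem regionCount_insert [DecidableEq ι] (f : ι → Module.Dual ℚ M) (X : Submodule ℚ M)
    {s : Finset ι} {e : ι} (he : e ∉ s) (hX : ¬ X ≤ LinearMap.ker (f e)) :
    regionCount f X (insert e s) =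
      regionCount f X s + regionCount f (X ⊓ LinearMap.ker (f e)) s := by
  classical
  obtain ⟨y, hyX, hy⟩ : ∃ y ∈ X, 0 < f e y := by
    obtain ⟨y, hyX, hy⟩ := SetLike.not_le_iff_exists.1 hX
    rw [LinearMap.mem_ker] at hy
    rcases lt_or_gt_of_ne hy with h | h
    · exact ⟨-y, X.neg_mem hyX, by simpa using h⟩
    · exact ⟨y, hyX, h⟩
  have h1 : regionCount f X (insert e s) =
      (s.powerset.filter fun P => IsRegion f X (insert e s) P).card +
      (s.powerset.filter fun P => IsRegion f X (insert e s) (insert e P)).card := by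
    rw [regionCount, Finset.powerset_insert, Finset.filter_union, Finset.card_union_of_disjoint]
    · congr 1
      rw [Finset.filter_image, Finset.card_image_of_injOn]
      intro P hP Q hQ h
      simp only [Finset.coe_filter, Finset.mem_powerset, Set.mem_ofPred_eq] at hP hQ
      rw [← Finset.erase_insert (fun h => he (hP.1 h)), h,
        Finset.erase_insert (fun h => he (hQ.1 h))]
    · rw [Finset.disjoint_left]
      intro P hP hQ
      simp only [Finset.mem_filter, Finset.mem_powerset, Finset.mem_image] at hP hQ
      obtain ⟨⟨Q, _, rfl⟩, _⟩ := hQ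
      exact he (hP.1 (Finset.mem_insert_self _ _))
  have h2 : regionCount f X s = (s.powerset.filter fun P =>
      IsRegion f X (insert e s) P ∨ IsRegion f X (insert e s) (insert e P)).card := by
    rw [regionCount]
    congr 1
    refine Finset.filter_congr fun P hP => ?_
    rw [isRegion_insert_neg he (Finset.mem_powerset.1 hP), isRegion_insert_pos he]
    constructor
    · rintro ⟨x, hx, h⟩
      rcases lt_trichotomy (f e x) 0 with h0 | h0 | h0
      · exact Or.inl ⟨x, hx, h, h0⟩
      · obtain ⟨δ, hδ, h'⟩ := exists_pos_perturb h y
        refine Or.inr ⟨x + δ • y, X.add_mem hx (X.smul_mem _ hyX), h', ?_⟩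
        simpa [h0] using mul_pos hδ hy
      · exact Or.inr ⟨x, hx, h, h0⟩
    · rintro (⟨x, hx, h, -⟩ | ⟨x, hx, h, -⟩) <;> exact ⟨x, hx, h⟩
  have h3 : regionCount f (X ⊓ LinearMap.ker (f e)) s = (s.powerset.filter fun P =>
      IsRegion f X (insert e s) P ∧ IsRegion f X (insert e s) (insert e P)).card := by
    rw [regionCount]
    congr 1
    refine Finset.filter_congr fun P hP => ?_
    rw [isRegion_insert_neg he (Finset.mem_powerset.1 hP), isRegion_insert_pos he]
    constructor
    · rintro ⟨x, hx, h⟩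
      rw [Submodule.mem_inf, LinearMap.mem_ker] at hx
      obtain ⟨δ, hδ, h'⟩ := exists_pos_perturb h y
      obtain ⟨δ', hδ', h''⟩ := exists_pos_perturb h (-y)
      refine ⟨⟨x + δ' • -y, X.add_mem hx.1 (X.smul_mem _ (X.neg_mem hyX)), h'', ?_⟩,
        ⟨x + δ • y, X.add_mem hx.1 (X.smul_mem _ hyX), h', ?_⟩⟩
      · simpa [hx.2] using mul_pos hδ' hy
      · simpa [hx.2] using mul_pos hδ hy
    · rintro ⟨⟨x, hx, h, hn⟩, ⟨x', hx', h', hp⟩⟩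
      -- the point where the segment from `x` to `x'` meets the hyperplane, scaled
      refine ⟨f e x' • x + (-f e x) • x', ⟨X.add_mem (X.smul_mem _ hx) (X.smul_mem _ hx'), ?_⟩,
        fun i hi => ⟨fun hiP => ?_, fun hiP => ?_⟩⟩
      · simp; ring
      · have := mul_pos hp ((h i hi).1 hiP)
        have := mul_pos (neg_pos.2 hn) ((h' i hi).1 hiP)
        simp only [map_add, map_smul, smul_eq_mul]; linarith
      · have := mul_neg_of_pos_of_neg hp ((h i hi).2 hiP)
        have := mul_neg_of_pos_of_neg (neg_pos.2 hn) ((h' i hi).2 hiP)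
        simp only [map_add, map_smul, smul_eq_mul]; linarith
  rw [h1, h2, h3, Finset.filter_or, Finset.filter_and, Finset.card_union_add_card_inter]

/-- Zaslavsky's formula for the number of regions of a hyperplane arrangement, by deletion and
restriction. -/
theorem sum_powerset_neg_one_pow_finrank [FiniteDimensional ℚ M] (f : ι → Module.Dual ℚ M)
    (s : Finset ι) (X : Submodule ℚ M) :
    ∑ S ∈ s.powerset, (-1 : ℚ) ^ S.card *
        (-1) ^ Module.finrank ℚ ↥(X ⊓ ⨅ e ∈ S, LinearMap.ker (f e)) =
      (-1) ^ Module.finrank ℚ X * regionCount f X s := by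
  classical
  induction s using Finset.induction_on generalizing X with
  | empty =>
    have : regionCount f X ∅ = 1 := by
      rw [regionCount, Finset.powerset_empty, Finset.filter_true_of_mem, Finset.card_singleton]
      exact fun P _ => ⟨0, X.zero_mem, by simp⟩
    have h0 : X ⊓ ⨅ e ∈ (∅ : Finset ι), LinearMap.ker (f e) = X := by simp
    rw [Finset.powerset_empty, Finset.sum_singleton, h0, this]
    simp
  | insert e s he ih =>
    have step : ∀ S ∈ s.powerset, (-1 : ℚ) ^ (insert e S).card *
          (-1) ^ Module.finrank ℚ ↥(X ⊓ ⨅ i ∈ insert e S, LinearMap.ker (f i)) =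
        -((-1 : ℚ) ^ S.card *
          (-1) ^ Module.finrank ℚ ↥((X ⊓ LinearMap.ker (f e)) ⊓ ⨅ i ∈ S, LinearMap.ker (f i))) := by
      intro S hS
      have heS : e ∉ S := fun h => he (Finset.mem_powerset.1 hS h)
      rw [Finset.card_insert_of_notMem heS, Finset.iInf_insert, inf_assoc, pow_succ]
      ring
    rw [Finset.sum_powerset_insert he, Finset.sum_congr rfl step, Finset.sum_neg_distrib, ih, ih]
    by_cases hX : X ≤ LinearMap.ker (f e)
    · have h0 : regionCount f X (insert e s) = 0 := by
        rw [regionCount, Finset.card_eq_zero, Finset.filter_eq_empty_iff]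
        rintro P - ⟨x, hx, h⟩
        have h1 : f e x = 0 := hX hx
        have := h e (Finset.mem_insert_self _ _)
        rw [h1] at this
        by_cases hP : e ∈ P
        · exact lt_irrefl _ (this.1 hP)
        · exact lt_irrefl _ (this.2 hP)
      rw [inf_eq_left.2 hX, h0]
      simp
    · have hdim : Module.finrank ℚ X = Module.finrank ℚ ↥(X ⊓ LinearMap.ker (f e)) + 1 := by
        have hne : (f e).domRestrict X ≠ 0 := fun h => hX fun x hx => by
          simpa using LinearMap.congr_fun h ⟨x, hx⟩
        have h1 := Module.Dual.finrank_ker_add_one_of_ne_zero hne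
        rw [← h1, LinearMap.ker_domRestrict, ← Submodule.map_comap_subtype,
          Submodule.finrank_map_subtype_eq]
      rw [regionCount_insert f X he hX, hdim]
      push_cast
      ring

end Regions

/-! ### Acyclic orientations as regions -/

namespace SignedGraph

section Orientations

variable {V E : Type*} (G : SignedGraph V E)

/-- The linear functional `κ ↦ κ u - sgn e * κ v` of an edge `e : uv`. -/
noncomputable def edgeForm (e : E) : Module.Dual ℚ (V → ℚ) :=
  LinearMap.proj (G.ends e false) - ((G.sgn e : ℤ) : ℚ) • LinearMap.proj (G.ends e true)

theorem edgeForm_apply (e : E) (κ : V → ℚ) :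
    G.edgeForm e κ = κ (G.ends e false) - ((G.sgn e : ℤ) : ℚ) * κ (G.ends e true) := by
  simp [edgeForm]

/-- An arrow as a number: `1` if it points toward its vertex, `-1` if it points away from it. -/
def arrow (b : Bool) : ℚ := if b then 1 else -1

@[simp] theorem arrow_true : arrow true = 1 := rfl
@[simp] theorem arrow_false : arrow false = -1 := rfl

theorem abs_arrow_mul (b : Bool) (x : ℚ) : |arrow b * x| = |x| := by cases b <;> simp

variable {G}

theorem IsOrientation.arrow_true_eq {τ : E → Bool → Bool} (h : G.IsOrientation τ) (e : E) :
    arrow (τ e true) = -(((G.sgn e : ℤ) : ℚ) * arrow (τ e false)) := by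
  rcases Int.units_eq_one_or (G.sgn e) with hs | hs
  · have := (h e).1 hs
    cases h1 : τ e true <;> cases h2 : τ e false <;> simp_all
  · have := (h e).2 hs
    cases h1 : τ e true <;> cases h2 : τ e false <;> simp_all

/-- The functional of an edge, with the sign of the arrow at its `false` end, is the sum of the
values at the two ends with the arrows as signs. -/
theorem IsOrientation.arrow_mul_edgeForm {τ : E → Bool → Bool} (h : G.IsOrientation τ) (e : E)
    (s : Bool) (κ : V → ℚ) :
    arrow (τ e false) * G.edgeForm e κ =
      arrow (τ e s) * κ (G.ends e s) + arrow (τ e !s) * κ (G.ends e !s) := by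
  rw [edgeForm_apply]
  cases s
  · rw [Bool.not_false, h.arrow_true_eq]; ring
  · rw [Bool.not_true, h.arrow_true_eq]; ring

/-- An orientation is determined on an edge by either of the two arrows. -/
theorem IsOrientation.eq_of_eq {τ τ' : E → Bool → Bool} (h : G.IsOrientation τ)
    (h' : G.IsOrientation τ') {e : E} {s : Bool} (hs : τ e s = τ' e s) : τ e = τ' e := by
  funext t
  have h1 := h e
  have h2 := h' e
  rcases Int.units_eq_one_or (G.sgn e) with hs | hs <;>
  · simp only [hs] at h1 h2
    cases s <;> cases t <;> cases h3 : τ e false <;> cases h4 : τ e true <;>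
      cases h5 : τ' e false <;> cases h6 : τ' e true <;> simp_all

/-- The functional of `e`, signed by `τ`, is the sum of `κ` over the ends of `e` with the arrows as
signs; a vertex where `|κ|` is maximal on a cycle has an arrow that makes such a sum nonpositive. -/
theorem IsOrientation.isAcyclic_of_pos {τ : E → Bool → Bool} (h : G.IsOrientation τ) {κ : V → ℚ}
    (hκ : ∀ e, 0 < arrow (τ e false) * G.edgeForm e κ) : G.IsAcyclic τ := by
  rintro n w ⟨hw, hc⟩
  obtain ⟨i, hi⟩ := Finite.exists_max fun i => |κ (G.ends (w i).1 (w i).2)|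
  have hmax : ∀ j s, |κ (G.ends (w j).1 s)| ≤ |κ (G.ends (w i).1 (w i).2)| := by
    intro j s
    by_cases hs : s = (w j).2
    · rw [hs]; exact hi j
    · have : s = !(w j).2 := by cases s <;> cases h : (w j).2 <;> simp_all
      rw [this, hw j]; exact hi (j + 1)
  obtain ⟨d, hd⟩ : ∃ d, arrow d * κ (G.ends (w i).1 (w i).2) =
      -|κ (G.ends (w i).1 (w i).2)| := by
    rcases abs_choice (κ (G.ends (w i).1 (w i).2)) with h | h
    · exact ⟨false, by rw [h]; simp⟩
    · exact ⟨true, by rw [h]; simp⟩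
  obtain ⟨j, s, hj, hτ⟩ := hc i d
  have h1 := hκ (w j).1
  rw [h.arrow_mul_edgeForm _ s, hτ, hj, hd] at h1
  have h2 := le_abs_self (arrow (τ (w j).1 !s) * κ (G.ends (w j).1 !s))
  rw [abs_arrow_mul] at h2
  linarith [hmax j (!s)]

/-- In an acyclic orientation every nonempty set of edges has a source or a sink: otherwise one can
leave every vertex by an arrow opposite to the one of the arrival, and this eventually closes. -/
theorem IsAcyclic.exists_extremal [Finite E] {τ : E → Bool → Bool} (h : G.IsAcyclic τ)
    {F : Finset E} (hF : F.Nonempty) :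
    ∃ e ∈ F, ∃ s d, ∀ e' ∈ F, ∀ s', G.ends e' s' = G.ends e s → τ e' s' = d := by
  by_contra! hcon
  -- a step `(e, s)` arrives by the arrow at `(e, !s)`; the next one leaves by an opposite arrow
  have hstep : ∀ x : F × Bool, ∃ y : F × Bool, G.ends y.1 y.2 = G.ends x.1 (!x.2) ∧
      τ y.1 y.2 = !τ x.1 (!x.2) := by
    rintro ⟨⟨e, he⟩, s⟩
    obtain ⟨e', he', s', h1, h2⟩ := hcon e he (!s) (τ e !s)
    refine ⟨(⟨e', he'⟩, s'), h1, ?_⟩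
    cases h3 : τ e' s' <;> cases h4 : τ e !s <;> simp_all
  choose next hnext1 hnext2 using hstep
  obtain ⟨e₀, he₀⟩ := hF
  obtain ⟨x, n, hn⟩ : ∃ x, ∃ n, next^[n + 1] x = x := by
    obtain ⟨a, b, hne, hab⟩ := Finite.exists_ne_map_eq_of_infinite
      fun k : ℕ => next^[k] (⟨e₀, he₀⟩, false)
    wlog hlt : a < b generalizing a b
    · exact this b a hne.symm hab.symm (lt_of_le_of_ne (not_lt.1 hlt) hne.symm)
    refine ⟨next^[a] (⟨e₀, he₀⟩, false), b - a - 1, ?_⟩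
    rw [← Function.iterate_add_apply, show b - a - 1 + 1 + a = b by omega]
    exact hab.symm
  have hsucc : ∀ i : Fin (n + 1),
      next^[((i + 1 : Fin (n + 1)) : ℕ)] x = next (next^[(i : ℕ)] x) := by
    intro i
    rw [← Function.iterate_succ_apply' next]
    by_cases hi : i = Fin.last n
    · subst hi
      rw [Fin.last_add_one, Fin.val_last, Fin.val_zero, Nat.succ_eq_add_one, hn]; rfl
    · rw [Fin.val_add_one_of_lt (Fin.lt_last_iff_ne_last.2 hi)]
  refine h n (fun i => (((next^[(i : ℕ)] x).1 : E), (next^[(i : ℕ)] x).2)) ⟨fun i => ?_, ?_⟩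
  · simp only [hsucc i]
    exact (hnext1 _).symm
  · intro i d
    obtain ⟨k, rfl⟩ : ∃ k, i = k + 1 := ⟨i - 1, by simp⟩
    simp only [hsucc k]
    by_cases hd : τ (next (next^[(k : ℕ)] x)).1 (next (next^[(k : ℕ)] x)).2 = d
    · exact ⟨k + 1, _, by rw [hsucc k], by rw [hsucc k]; exact hd⟩
    · refine ⟨k, !(next^[(k : ℕ)] x).2, (hnext1 _).symm, ?_⟩
      rw [hnext2] at hd
      revert hd
      cases d <;> simp

/-- An acyclic orientation is realized by a vector, built by removing sources and sinks one by one.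
-/
theorem IsOrientation.exists_pos_on [Finite E] [Fintype V] {τ : E → Bool → Bool}
    (h : G.IsOrientation τ) (ha : G.IsAcyclic τ) (F : Finset E) :
    ∃ κ : V → ℚ, ∀ e ∈ F, 0 < arrow (τ e false) * G.edgeForm e κ := by
  classical
  induction F using Finset.strongInduction with
  | H F ih =>
    rcases F.eq_empty_or_nonempty with rfl | hF
    · exact ⟨0, by simp⟩
    obtain ⟨e₀, he₀, s₀, d, hd⟩ := ha.exists_extremal hF
    set v := G.ends e₀ s₀ with hv
    obtain ⟨κ, hκ⟩ := ih (F.filter fun e => ∀ s, G.ends e s ≠ v)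
      (Finset.filter_ssubset.2 ⟨e₀, he₀, fun h => h s₀ hv.symm⟩)
    -- give the source or sink `v` a value of the right sign that dominates all others
    set M : ℚ := 1 + ∑ u, |κ u| with hM
    have hle : ∀ u, |κ u| < M := fun u => by
      have := Finset.single_le_sum (f := fun u => |κ u|) (fun i _ => abs_nonneg _)
        (Finset.mem_univ u)
      linarith
    refine ⟨Function.update κ v (arrow d * M), fun e he => ?_⟩
    have hM0 : 0 < M := lt_of_le_of_lt (abs_nonneg _) (hle v)
    have hdd : arrow d * (arrow d * M) = M := by cases d <;> simp
    by_cases hev : ∃ s, G.ends e s = v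
    · obtain ⟨s, hs⟩ := hev
      rw [h.arrow_mul_edgeForm e s, hs, Function.update_self, hd e he s hs, hdd]
      by_cases ht : G.ends e (!s) = v
      · rw [ht, Function.update_self, hd e he _ ht, hdd]
        linarith
      · rw [Function.update_of_ne ht]
        have := neg_abs_le (arrow (τ e !s) * κ (G.ends e !s))
        rw [abs_arrow_mul] at this
        linarith [hle (G.ends e !s)]
    · push Not at hev
      have := hκ e (Finset.mem_filter.2 ⟨he, hev⟩)
      rw [edgeForm_apply] at this ⊢
      rwa [Function.update_of_ne (hev _), Function.update_of_ne (hev _)]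

/-- The acyclic orientations are the regions of the arrangement of the hyperplanes
`κ u = sgn e * κ v`. -/
theorem IsOrientation.isAcyclic_iff [Fintype E] [Fintype V] {τ : E → Bool → Bool}
    (h : G.IsOrientation τ) :
    G.IsAcyclic τ ↔ ∃ κ : V → ℚ, ∀ e, 0 < arrow (τ e false) * G.edgeForm e κ :=
  ⟨fun ha => by simpa using h.exists_pos_on ha Finset.univ,
    fun ⟨_, hκ⟩ => h.isAcyclic_of_pos hκ⟩

end Orientations

section Sinks

variable {V E : Type*} (G : SignedGraph V E)

/-- The indicator vector of a set of vertices. -/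
noncomputable def indic (W : Finset V) : V → ℚ := Set.indicator (W : Set V) 1

theorem indic_of_mem {W : Finset V} {v : V} (h : v ∈ W) : indic W v = 1 := by
  simp [indic, h]

theorem indic_of_notMem {W : Finset V} {v : V} (h : v ∉ W) : indic W v = 0 := by
  simp [indic, h]

/-- The vectors that vanish on `W`. -/
def vanishing (W : Finset V) : Submodule ℚ (V → ℚ) where
  carrier := {κ | ∀ v ∈ W, κ v = 0}
  zero_mem' := fun _ _ => rfl
  add_mem' := fun ha hb v hv => by simp [ha v hv, hb v hv]
  smul_mem' := fun c x hx v hv => by simp [hx v hv]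

open Classical in
/-- The edges `e` whose functional vanishes on the indicator vector of `W`: the edges with no end in
`W`, and the positive edges with both ends in `W`. -/
noncomputable def evenEdges [Fintype E] (W : Finset V) : Finset E :=
  Finset.univ.filter fun e => G.edgeForm e (indic W) = 0

theorem edgeForm_indic_eq_zero_iff {W : Finset V} {e : E} :
    G.edgeForm e (indic W) = 0 ↔ (∀ s, G.ends e s ∉ W) ∨ (G.sgn e = 1 ∧ ∀ s, G.ends e s ∈ W) := by
  rw [edgeForm_apply, Bool.forall_bool, Bool.forall_bool]
  by_cases h1 : G.ends e false ∈ W <;> by_cases h2 : G.ends e true ∈ W <;>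
    rcases Int.units_eq_one_or (G.sgn e) with hs | hs <;>
    simp [h1, h2, hs, indic_of_mem, indic_of_notMem]

open Classical in
/-- The acyclic orientations in which all vertices of `W` are sinks correspond to the regions of an
arrangement: the edges outside `evenEdges` meet `W` and so have no choice, and a positive edge
inside `W` excludes both such an orientation and such a region. -/
theorem card_acyclic_sinks [Fintype V] [Fintype E] (W : Finset V) :
    (Finset.univ.filter fun τ : E → Bool → Bool =>
      (G.IsOrientation τ ∧ G.IsAcyclic τ) ∧ ∀ v ∈ W, G.IsSink τ v).card =
      regionCount G.edgeForm (vanishing W) (G.evenEdges W) := by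
  rw [regionCount]
  refine Finset.card_nbij (fun τ => (G.evenEdges W).filter fun e => τ e false = true) ?_ ?_ ?_
  · intro τ hτ
    obtain ⟨⟨ho, ha⟩, hs⟩ := (Finset.mem_filter.1 hτ).2
    obtain ⟨κ, hκ⟩ := ho.isAcyclic_iff.1 ha
    refine Finset.mem_filter.2 ⟨Finset.mem_powerset.2 (Finset.filter_subset _ _),
      fun v => if v ∈ W then 0 else κ v, fun v hv => if_pos hv, fun e he => ?_⟩
    have hend : ∀ s, G.ends e s ∉ W := by
      rcases G.edgeForm_indic_eq_zero_iff.1 (Finset.mem_filter.1 he).2 with h | ⟨h1, h2⟩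
      · exact h
      · exact absurd ((hs _ (h2 false) e false rfl).trans (hs _ (h2 true) e true rfl).symm)
          ((ho e).1 h1)
    have hval := hκ e
    rw [edgeForm_apply] at hval ⊢
    simp only [hend, if_false, Finset.mem_filter, he, true_and]
    cases h : τ e false <;> simpa [h] using hval
  · intro τ hτ τ' hτ' heq
    obtain ⟨⟨ho, ha⟩, hs⟩ := (Finset.mem_filter.1 (Finset.mem_coe.1 hτ)).2
    obtain ⟨⟨ho', ha'⟩, hs'⟩ := (Finset.mem_filter.1 (Finset.mem_coe.1 hτ')).2
    funext e
    by_cases he : e ∈ G.evenEdges W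
    · refine ho.eq_of_eq ho' (s := false) ?_
      have := Finset.ext_iff.1 heq e
      simp only [Finset.mem_filter, he, true_and] at this
      exact Bool.eq_iff_iff.2 this
    · have : ¬ ∀ s, G.ends e s ∉ W := fun h => he (Finset.mem_filter.2
        ⟨Finset.mem_univ _, G.edgeForm_indic_eq_zero_iff.2 (Or.inl h)⟩)
      push Not at this
      obtain ⟨s, hsW⟩ := this
      exact ho.eq_of_eq ho' ((hs _ hsW e s rfl).trans (hs' _ hsW e s rfl).symm)
  · intro P hP
    obtain ⟨hPs, κ, hκW, hκ⟩ := Finset.mem_filter.1 (Finset.mem_coe.1 hP)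
    rw [Finset.mem_powerset] at hPs
    have hend : ∀ e ∈ G.evenEdges W, ∀ s, G.ends e s ∉ W := by
      intro e he
      rcases G.edgeForm_indic_eq_zero_iff.1 (Finset.mem_filter.1 he).2 with h | ⟨h1, h2⟩
      · exact h
      · have := hκ e he
        rw [edgeForm_apply, hκW _ (h2 false), hκW _ (h2 true)] at this
        by_cases heP : e ∈ P
        · simpa using this.1 heP
        · simpa using this.2 heP
    -- raise the vertices of `W` above all others
    set M : ℚ := 1 + ∑ u, |κ u| with hM
    have hle : ∀ u, |κ u| < M := fun u => by
      have := Finset.single_le_sum (f := fun u => |κ u|) (fun i _ => abs_nonneg _)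
        (Finset.mem_univ u)
      linarith
    set μ : V → ℚ := fun v => if v ∈ W then M else κ v with hμ
    have hμ1 : ∀ v ∈ W, μ v = M := fun v hv => if_pos hv
    have hμ2 : ∀ v ∉ W, μ v = κ v := fun v hv => if_neg hv
    set τ : E → Bool → Bool := fun e s =>
      if s = false ∨ G.sgn e = -1 then decide (0 < G.edgeForm e μ)
      else !decide (0 < G.edgeForm e μ) with hτ
    have hτ0 : ∀ e, τ e false = decide (0 < G.edgeForm e μ) := fun e => by simp [hτ]
    have ho : G.IsOrientation τ := by
      intro e
      refine ⟨fun h => ?_, fun h => ?_⟩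
      · simp [hτ, h]
      · simp [hτ, h]
    have heven : ∀ e ∈ G.evenEdges W, G.edgeForm e μ = G.edgeForm e κ := fun e he => by
      rw [edgeForm_apply, edgeForm_apply, hμ2 _ (hend e he _), hμ2 _ (hend e he _)]
    have hnonneg : ∀ e, 0 ≤ arrow (τ e false) * G.edgeForm e μ := fun e => by
      rw [hτ0]
      by_cases h : 0 < G.edgeForm e μ
      · simp [h, h.le]
      · rw [decide_eq_false h, arrow_false]
        linarith
    have hsink : ∀ v ∈ W, G.IsSink τ v := by
      rintro v hv e s rfl
      by_contra hf
      rw [Bool.not_eq_true] at hf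
      have h0 := hnonneg e
      rw [ho.arrow_mul_edgeForm e s, hf, hμ1 _ hv, arrow_false] at h0
      have hMpos : 0 < M := lt_of_le_of_lt (abs_nonneg _) (hle (G.ends e s))
      by_cases ht : G.ends e (!s) ∈ W
      · have hsgn : G.sgn e = -1 := by
          rcases Int.units_eq_one_or (G.sgn e) with h | h
          · refine absurd hv (hend e (Finset.mem_filter.2 ⟨Finset.mem_univ _,
              G.edgeForm_indic_eq_zero_iff.2 (Or.inr ⟨h, fun t => ?_⟩)⟩) s)
            cases s <;> cases t <;> first | exact hv | exact ht
          · exact h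
        have : τ e (!s) = false := by
          have := (ho e).2 hsgn
          cases s <;> simp_all
        rw [this, hμ1 _ ht, arrow_false] at h0
        linarith
      · rw [hμ2 _ ht] at h0
        have := le_abs_self (arrow (τ e !s) * κ (G.ends e !s))
        rw [abs_arrow_mul] at this
        linarith [hle (G.ends e !s)]
    have hpos : ∀ e, 0 < arrow (τ e false) * G.edgeForm e μ := by
      intro e
      refine lt_of_le_of_ne (hnonneg e) fun h0 => ?_
      by_cases he : e ∈ G.evenEdges W
      · have h1 : G.edgeForm e κ = 0 := by
          rw [← heven e he]
          cases h : τ e false <;> simpa [h] using h0.symm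
        have := hκ e he
        rw [h1] at this
        by_cases heP : e ∈ P
        · exact lt_irrefl _ (this.1 heP)
        · exact lt_irrefl _ (this.2 heP)
      · have : ¬ ∀ s, G.ends e s ∉ W := fun h => he (Finset.mem_filter.2
          ⟨Finset.mem_univ _, G.edgeForm_indic_eq_zero_iff.2 (Or.inl h)⟩)
        push Not at this
        obtain ⟨s, hsW⟩ := this
        have hMpos : 0 < M := lt_of_le_of_lt (abs_nonneg _) (hle (G.ends e s))
        rw [ho.arrow_mul_edgeForm e s, hsink _ hsW e s rfl, hμ1 _ hsW, arrow_true] at h0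
        by_cases ht : G.ends e (!s) ∈ W
        · rw [hsink _ ht e _ rfl, hμ1 _ ht, arrow_true] at h0
          linarith
        · rw [hμ2 _ ht] at h0
          have := neg_abs_le (arrow (τ e !s) * κ (G.ends e !s))
          rw [abs_arrow_mul] at this
          linarith [hle (G.ends e !s)]
    refine ⟨τ, Finset.mem_coe.2 (Finset.mem_filter.2 ⟨Finset.mem_univ _,
      ⟨ho, ho.isAcyclic_of_pos hpos⟩, hsink⟩), ?_⟩
    ext e
    simp only [Finset.mem_filter, hτ0, decide_eq_true_eq]
    constructor
    · rintro ⟨he, h⟩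
      by_contra heP
      rw [heven e he] at h
      exact lt_asymm h ((hκ e he).2 heP)
    · intro heP
      exact ⟨hPs heP, by rw [heven e (hPs heP)]; exact (hκ e (hPs heP)).1 heP⟩

end Sinks

end SignedGraph

/-! ### Signed partitions and flats -/

/-- A partial partition of `V` with signs: `sign v = 0` for the vertices outside all blocks, and
otherwise `rep v` is the representative of the block of `v`, and `sign v ∈ {1, -1}` is the sign of
`v` relative to it. -/
structure SignedPartition (V : Type*) where
  rep : V → V
  sign : V → ℤ
  sign_cases : ∀ v, sign v = 0 ∨ sign v = 1 ∨ sign v = -1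
  sign_rep : ∀ v, sign v ≠ 0 → sign (rep v) = 1
  rep_rep : ∀ v, sign v ≠ 0 → rep (rep v) = rep v

namespace SignedPartition

variable {V : Type*} (P : SignedPartition V)

/-- The functions with `κ v = ± κ (rep v)` on the blocks, with the signs of the partition, and
`κ v = 0` outside all blocks. -/
def space : Submodule ℚ (V → ℚ) where
  carrier := {κ | ∀ v, κ v = P.sign v * κ (P.rep v)}
  zero_mem' := fun _ => by simp
  add_mem' := fun ha hb v => by simp only [Pi.add_apply, mul_add, ← ha v, ← hb v]
  smul_mem' := fun c x hx v => by
    simp only [Pi.smul_apply, smul_eq_mul, mul_left_comm _ c, ← hx v]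

theorem mem_space {κ : V → ℚ} : κ ∈ P.space ↔ ∀ v, κ v = P.sign v * κ (P.rep v) := Iff.rfl

variable [Fintype V]

open Classical in
/-- The set of representatives of the blocks. -/
noncomputable def roots : Finset V := Finset.univ.filter fun v => P.sign v = 1 ∧ P.rep v = v

open Classical in
/-- The vertices of the block of `r` that have the given sign. -/
noncomputable def part (c : ℤ) (r : V) : Finset V :=
  Finset.univ.filter fun v => P.rep v = r ∧ P.sign v = c

open Classical in
/-- The vertices outside all blocks. -/
noncomputable def zeros : Finset V := Finset.univ.filter fun v => P.sign v = 0

variable {P}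

theorem mem_roots {v : V} : v ∈ P.roots ↔ P.sign v = 1 ∧ P.rep v = v := by simp [roots]

theorem rep_mem_roots {v : V} (h : P.sign v ≠ 0) : P.rep v ∈ P.roots :=
  mem_roots.2 ⟨P.sign_rep v h, P.rep_rep v h⟩

theorem mem_part {c : ℤ} {r v : V} : v ∈ P.part c r ↔ P.rep v = r ∧ P.sign v = c := by simp [part]

theorem mem_zeros {v : V} : v ∈ P.zeros ↔ P.sign v = 0 := by simp [zeros]

variable (P)

/-- Every vertex is outside all blocks or in exactly one of the two parts of one block. -/
theorem sum_eq_sum_parts {A : Type*} [AddCommMonoid A] (g : V → A) :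
    ∑ v, g v = ∑ v ∈ P.zeros, g v +
      ∑ r ∈ P.roots, (∑ v ∈ P.part 1 r, g v + ∑ v ∈ P.part (-1) r, g v) := by
  classical
  rw [← Finset.sum_filter_add_sum_filter_not Finset.univ (fun v => P.sign v = 0)]
  have hz : Finset.univ.filter (fun v => P.sign v = 0) = P.zeros := by
    ext v; simp [mem_zeros]
  rw [hz]
  congr 1
  rw [← Finset.sum_fiberwise_of_maps_to (t := P.roots) (g := P.rep)
    fun v hv => rep_mem_roots (Finset.mem_filter.1 hv).2]
  refine Finset.sum_congr rfl fun r _ => ?_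
  rw [← Finset.sum_union]
  · refine Finset.sum_congr ?_ fun _ _ => rfl
    ext v
    simp only [Finset.mem_filter, Finset.mem_univ, true_and, Finset.mem_union, mem_part]
    rcases P.sign_cases v with h | h | h <;> simp [h]
  · rw [Finset.disjoint_left]
    intro v h1 h2
    have h1 := (mem_part.1 h1).2
    have h2 := (mem_part.1 h2).2
    omega

theorem card_eq : Fintype.card V =
    P.zeros.card + ∑ r ∈ P.roots, ((P.part 1 r).card + (P.part (-1) r).card) := by
  have := P.sum_eq_sum_parts fun _ => 1
  simpa using this

theorem one_le_card_part {r : V} (hr : r ∈ P.roots) : 1 ≤ (P.part 1 r).card :=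
  Finset.card_pos.2 ⟨r, mem_part.2 ⟨(mem_roots.1 hr).2, (mem_roots.1 hr).1⟩⟩

open Classical in
/-- The union of the blocks with representatives in `T`. -/
noncomputable def block (T : Finset V) : Finset V :=
  Finset.univ.filter fun v => P.sign v ≠ 0 ∧ P.rep v ∈ T

variable {P}

theorem mem_block {T : Finset V} {v : V} : v ∈ P.block T ↔ P.sign v ≠ 0 ∧ P.rep v ∈ T := by
  simp [block]

theorem card_block {T : Finset V} (h : ∀ r ∈ T, P.part (-1) r = ∅) :
    (P.block T).card = ∑ r ∈ T, (P.part 1 r).card := by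
  classical
  rw [Finset.card_eq_sum_card_fiberwise (f := P.rep) (t := T)
    fun v hv => (mem_block.1 (Finset.mem_coe.1 hv)).2]
  refine Finset.sum_congr rfl fun r hr => ?_
  congr 1
  ext v
  simp only [Finset.mem_filter, mem_block, mem_part]
  constructor
  · rintro ⟨⟨h0, -⟩, rfl⟩
    refine ⟨rfl, ?_⟩
    rcases P.sign_cases v with h1 | h1 | h1
    · exact absurd h1 h0
    · exact h1
    · have := Finset.eq_empty_iff_forall_notMem.1 (h _ hr) v
      exact absurd (mem_part.2 ⟨rfl, h1⟩) this
  · rintro ⟨rfl, h1⟩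
    exact ⟨⟨by omega, hr⟩, rfl⟩

theorem indic_block_mem_space {T : Finset V} (h : ∀ r ∈ T, P.part (-1) r = ∅) :
    SignedGraph.indic (P.block T) ∈ P.space := by
  intro v
  by_cases h0 : P.sign v = 0
  · rw [SignedGraph.indic_of_notMem fun hv => (mem_block.1 hv).1 h0, h0]
    simp
  have hr : P.sign (P.rep v) ≠ 0 := by rw [P.sign_rep v h0]; exact one_ne_zero
  by_cases hT : P.rep v ∈ T
  · have h1 : P.sign v = 1 := by
      rcases P.sign_cases v with h1 | h1 | h1
      · exact absurd h1 h0
      · exact h1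
      · exact absurd (mem_part.2 ⟨rfl, h1⟩) (Finset.eq_empty_iff_forall_notMem.1 (h _ hT) v)
    rw [SignedGraph.indic_of_mem (mem_block.2 ⟨h0, hT⟩),
      SignedGraph.indic_of_mem (mem_block.2 ⟨hr, by rwa [P.rep_rep v h0]⟩), h1]
    simp
  · rw [SignedGraph.indic_of_notMem fun hv => hT (mem_block.1 hv).2,
      SignedGraph.indic_of_notMem fun hv => hT (by
        have := (mem_block.1 hv).2
        rwa [P.rep_rep v h0] at this)]
    simp

theorem part_neg_eq_empty {W : Finset V} (h : SignedGraph.indic W ∈ P.space) {r : V}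
    (hr : r ∈ W) : P.part (-1) r = ∅ := by
  rw [Finset.eq_empty_iff_forall_notMem]
  intro v hv
  obtain ⟨h1, h2⟩ := mem_part.1 hv
  have := h v
  rw [h1, h2, SignedGraph.indic_of_mem hr] at this
  by_cases hvW : v ∈ W
  · rw [SignedGraph.indic_of_mem hvW] at this; norm_num at this
  · rw [SignedGraph.indic_of_notMem hvW] at this; norm_num at this

theorem block_filter_roots [DecidableEq V] {W : Finset V} (h : SignedGraph.indic W ∈ P.space) :
    P.block (P.roots.filter (· ∈ W)) = W := by
  ext v
  rw [mem_block, Finset.mem_filter]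
  have hv := h v
  constructor
  · rintro ⟨h0, -, h1⟩
    by_contra hW
    rw [SignedGraph.indic_of_notMem hW, SignedGraph.indic_of_mem h1, mul_one] at hv
    exact h0 (by exact_mod_cast hv.symm)
  · intro hW
    rw [SignedGraph.indic_of_mem hW] at hv
    have h0 : P.sign v ≠ 0 := fun h0 => by rw [h0] at hv; simp at hv
    refine ⟨h0, rep_mem_roots h0, ?_⟩
    by_contra h1
    rw [SignedGraph.indic_of_notMem h1] at hv
    simp at hv

theorem filter_roots_block [DecidableEq V] {T : Finset V} (hT : T ⊆ P.roots) :
    P.roots.filter (· ∈ P.block T) = T := by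
  ext r
  rw [Finset.mem_filter, mem_block, mem_roots]
  constructor
  · rintro ⟨⟨-, h1⟩, -, h2⟩
    rwa [h1] at h2
  · intro h
    obtain ⟨h1, h2⟩ := mem_roots.1 (hT h)
    exact ⟨⟨h1, h2⟩, by omega, by rwa [h2]⟩

/-- A vector of the space is given by its values at the representatives; those in `T` must be zero
for it to vanish on the blocks of `T`. -/
theorem finrank_space_inf_vanishing [DecidableEq V] (P : SignedPartition V) (T : Finset V) :
    Module.finrank ℚ ↥(P.space ⊓ SignedGraph.vanishing (P.block T)) = (P.roots \ T).card := by
  let φ : ↥(P.space ⊓ SignedGraph.vanishing (P.block T)) →ₗ[ℚ] (↥(P.roots \ T) → ℚ) :=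
    (LinearMap.funLeft ℚ ℚ Subtype.val).domRestrict _
  have hinj : Function.Injective φ := by
    rw [← LinearMap.ker_eq_bot, LinearMap.ker_eq_bot']
    rintro ⟨κ, h1, h2⟩ h0
    refine Subtype.ext (funext fun v => ?_)
    have h0' : ∀ r ∈ P.roots \ T, κ r = 0 := fun r hr => congrFun h0 ⟨r, hr⟩
    change κ v = 0
    by_cases hs : P.sign v = 0
    · rw [h1 v, hs]; simp
    · by_cases hv : P.rep v ∈ T
      · exact h2 v (mem_block.2 ⟨hs, hv⟩)
      · rw [h1 v, h0' _ (Finset.mem_sdiff.2 ⟨rep_mem_roots hs, hv⟩), mul_zero]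
  have hsurj : Function.Surjective φ := by
    intro y
    let κ : V → ℚ := fun v =>
      P.sign v * if h : P.rep v ∈ P.roots \ T then y ⟨P.rep v, h⟩ else 0
    refine ⟨⟨κ, fun v => ?_, fun v hv => ?_⟩, funext fun r => ?_⟩
    · by_cases hs : P.sign v = 0
      · simp [κ, hs]
      · simp only [κ, P.sign_rep v hs, P.rep_rep v hs, Int.cast_one, one_mul]
    · have : P.rep v ∉ P.roots \ T := fun h => (Finset.mem_sdiff.1 h).2 (mem_block.1 hv).2
      change (P.sign v : ℚ) * (if h : P.rep v ∈ P.roots \ T then y ⟨P.rep v, h⟩ else 0) = 0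
      rw [dif_neg this, mul_zero]
    · obtain ⟨h1, h2⟩ := mem_roots.1 (Finset.mem_sdiff.1 r.2).1
      have hr : P.rep r ∈ P.roots \ T := by rw [h2]; exact r.2
      change (P.sign r : ℚ) * (if h : P.rep r ∈ P.roots \ T then y ⟨P.rep r, h⟩ else 0) = y r
      rw [dif_pos hr, h1, Int.cast_one, one_mul]
      exact congrArg y (Subtype.ext h2)
  rw [(LinearEquiv.ofBijective φ ⟨hinj, hsurj⟩).finrank_eq, Module.finrank_fintype_fun_eq_card,
    Fintype.card_coe]

open Classical in
/-- Expansion of a product over the blocks: a choice of blocks all of whose signs are positive is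
the same as a set of vertices whose indicator vector lies in the space of the partition. -/
theorem prod_roots_eq_sum {A : Type*} [CommRing A] (P : SignedPartition V) (y : A) :
    (-1) ^ P.zeros.card * ∏ r ∈ P.roots,
      ((if (P.part (-1) r).card = 0 then y ^ (P.part 1 r).card else 0) -
        (-1) ^ ((P.part 1 r).card + (P.part (-1) r).card)) =
    ∑ W : Finset V, if SignedGraph.indic W ∈ P.space then
      y ^ W.card * (-1) ^ (Fintype.card V + W.card) *
        (-1) ^ Module.finrank ℚ ↥(P.space ⊓ SignedGraph.vanishing W) else 0 := by
  simp_rw [sub_eq_add_neg]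
  rw [Finset.prod_add, ← Finset.sum_filter_of_ne (p := fun T => ∀ r ∈ T, P.part (-1) r = ∅),
    ← Finset.sum_filter, Finset.mul_sum]
  · refine Finset.sum_nbij' P.block (fun W => P.roots.filter (· ∈ W)) ?_ ?_ ?_ ?_ ?_
    · intro T hT
      simp only [Finset.mem_filter, Finset.mem_powerset] at hT
      exact Finset.mem_filter.2 ⟨Finset.mem_univ _, indic_block_mem_space hT.2⟩
    · intro W hW
      simp only [Finset.mem_filter, Finset.mem_univ, true_and] at hW
      exact Finset.mem_filter.2 ⟨Finset.mem_powerset.2 (Finset.filter_subset _ _),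
        fun r hr => part_neg_eq_empty hW (Finset.mem_filter.1 hr).2⟩
    · intro T hT
      simp only [Finset.mem_filter, Finset.mem_powerset] at hT
      exact filter_roots_block hT.1
    · intro W hW
      exact block_filter_roots (Finset.mem_filter.1 hW).2
    · intro T hT
      simp only [Finset.mem_filter, Finset.mem_powerset] at hT
      obtain ⟨hT, hneg⟩ := hT
      have h1 : ∏ r ∈ T, (if (P.part (-1) r).card = 0 then y ^ (P.part 1 r).card else 0) =
          y ^ (P.block T).card := by
        rw [card_block hneg, ← Finset.prod_pow_eq_pow_sum]
        exact Finset.prod_congr rfl fun r hr => by simp [hneg r hr]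
      have h2 : Fintype.card V + (P.block T).card = P.zeros.card +
          (∑ r ∈ P.roots \ T, ((P.part 1 r).card + (P.part (-1) r).card) +
            2 * (P.block T).card) := by
        have h3 : ∑ r ∈ T, ((P.part 1 r).card + (P.part (-1) r).card) = (P.block T).card := by
          rw [card_block hneg]
          exact Finset.sum_congr rfl fun r hr => by simp [hneg r hr]
        rw [P.card_eq, ← Finset.sum_sdiff hT, h3]
        ring
      rw [h1, h2, finrank_space_inf_vanishing, Finset.prod_neg, Finset.prod_pow_eq_pow_sum,
        pow_add, pow_add, pow_mul]
      simp only [even_two, Even.neg_pow, one_pow, mul_one]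
      ring
  · intro T _ hne r hr
    by_contra h
    refine hne ?_
    rw [Finset.prod_eq_zero hr, zero_mul]
    rw [if_neg]
    rwa [Finset.card_eq_zero]

end SignedPartition

namespace SignedGraph

variable {V E : Type*} (G : SignedGraph V E)

/-- The functions that satisfy `κ u = sgn e * κ v` for all edges `e : uv` in `S`. -/
noncomputable def flat (S : Finset E) : Submodule ℚ (V → ℚ) :=
  ⨅ e ∈ S, LinearMap.ker (G.edgeForm e)

variable {G}

theorem mem_flat {S : Finset E} {κ : V → ℚ} :
    κ ∈ G.flat S ↔ ∀ e ∈ S, κ (G.ends e false) = ((G.sgn e : ℤ) : ℚ) * κ (G.ends e true) := by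
  simp [flat, Submodule.mem_iInf, edgeForm_apply, sub_eq_zero]

variable (G)

/-- Two vertices are in the same block when `κ u = κ v` on the whole flat or `κ u = - κ v` on the
whole flat, and a vertex is in no block when `κ v = 0` on the whole flat. -/
theorem exists_partition (S : Finset E) : ∃ P : SignedPartition V, P.space = G.flat S := by
  classical
  let K := G.flat S
  let R : Setoid V :=
    { r := fun u v => (∀ κ ∈ K, κ u = κ v) ∨ ∀ κ ∈ K, κ u = -κ v
      iseqv :=
        { refl := fun _ => Or.inl fun _ _ => rfl
          symm := by
            rintro u v (h | h)
            · exact Or.inl fun κ hκ => (h κ hκ).symm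
            · exact Or.inr fun κ hκ => by rw [h κ hκ, neg_neg]
          trans := by
            rintro u v w (h | h) (h' | h')
            · exact Or.inl fun κ hκ => by rw [h κ hκ, h' κ hκ]
            · exact Or.inr fun κ hκ => by rw [h κ hκ, h' κ hκ]
            · exact Or.inr fun κ hκ => by rw [h κ hκ, h' κ hκ]
            · exact Or.inl fun κ hκ => by rw [h κ hκ, h' κ hκ, neg_neg] } }
  let ρ : V → V := fun v => (Quotient.mk R v).out
  have hρ : ∀ v, R v (ρ v) := fun v => R.symm (Quotient.mk_out (s := R) v)
  have hρρ : ∀ u v, R u v → ρ u = ρ v := fun u v h => by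
    simp only [ρ, Quotient.sound (s := R) h]
  let ε : V → ℤ := fun v =>
    if ∀ κ ∈ K, κ v = 0 then 0 else if ∀ κ ∈ K, κ v = κ (ρ v) then 1 else -1
  have hε : ∀ κ ∈ K, ∀ v, κ v = ε v * κ (ρ v) := by
    intro κ hκ v
    by_cases h0 : ∀ κ ∈ K, κ v = 0
    · simp only [ε, if_pos h0, h0 κ hκ, Int.cast_zero, zero_mul]
    · by_cases h1 : ∀ κ ∈ K, κ v = κ (ρ v)
      · simp only [ε, if_neg h0, if_pos h1, Int.cast_one, one_mul, ← h1 κ hκ]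
      · simp only [ε, if_neg h0, if_neg h1]
        rw [((hρ v).resolve_left h1) κ hκ]
        simp
  have hne : ∀ v, ε v ≠ 0 → ¬ ∀ κ ∈ K, κ (ρ v) = 0 := by
    intro v hv h
    refine hv (if_pos fun κ hκ => ?_)
    rw [hε κ hκ, h κ hκ, mul_zero]
  refine ⟨⟨ρ, ε, fun v => ?_, fun v hv => ?_, fun v _ => (hρρ _ _ (hρ v)).symm⟩, ?_⟩
  · simp only [ε]
    split_ifs <;> simp
  · simp only [ε]
    rw [if_neg (hne v hv), if_pos]
    intro κ _
    rw [← hρρ _ _ (hρ v)]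
  · refine le_antisymm (fun κ hκ => mem_flat.2 fun e he => ?_) fun κ hκ v => hε κ hκ v
    have hedge : ∀ κ ∈ K, κ (G.ends e false) = ((G.sgn e : ℤ) : ℚ) * κ (G.ends e true) :=
      fun κ hκ => mem_flat.1 hκ e he
    have hrel : ρ (G.ends e false) = ρ (G.ends e true) := by
      refine hρρ _ _ ?_
      rcases Int.units_eq_one_or (G.sgn e) with hs | hs
      · exact Or.inl fun κ hκ => by simpa [hs] using hedge κ hκ
      · exact Or.inr fun κ hκ => by simpa [hs] using hedge κ hκ
    have hsign : (ε (G.ends e false) : ℚ) = (G.sgn e : ℤ) * (ε (G.ends e true)) := by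
      by_cases h : ∀ κ ∈ K, κ (ρ (G.ends e true)) = 0
      · have h1 : ε (G.ends e true) = 0 := by
          by_contra hc; exact hne _ hc h
        have h2 : ε (G.ends e false) = 0 := by
          by_contra hc; exact hne _ hc (by rwa [hrel])
        simp [h1, h2]
      · push Not at h
        obtain ⟨κ', hκ', h⟩ := h
        have := hedge κ' hκ'
        rw [hε κ' hκ' (G.ends e false), hε κ' hκ' (G.ends e true), hrel, ← mul_assoc] at this
        exact mul_right_cancel₀ h this
    have h1 := hκ (G.ends e false)
    have h2 := hκ (G.ends e true)
    simp only at h1 h2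
    rw [h1, h2, hrel, hsign, mul_assoc]

end SignedGraph

/-! ### The chromatic function and its weight -/

section MonomialSum

open MvPowerSeries

theorem coeff_monomialSum {ι : Type*} (a : ι → ℤ →₀ ℕ) (m : ℤ →₀ ℕ) :
    coeff m (monomialSum a) = (Nat.card {i // a i = m} : ℚ) := rfl

theorem monomialSum_congr {ι κ : Type*} (e : ι ≃ κ) {a : ι → ℤ →₀ ℕ} {b : κ → ℤ →₀ ℕ}
    (h : ∀ i, b (e i) = a i) : monomialSum a = monomialSum b := by
  ext m
  rw [coeff_monomialSum, coeff_monomialSum, Nat.cast_inj]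
  exact Nat.card_congr (e.subtypeEquiv fun i => by rw [h])

theorem monomialSum_const_add {ι : Type*} (n : ℤ →₀ ℕ) (a : ι → ℤ →₀ ℕ) :
    monomialSum (fun i => n + a i) = monomial n 1 * monomialSum a := by
  ext m
  rw [coeff_monomial_mul, coeff_monomialSum]
  split_ifs with h
  · rw [one_mul, coeff_monomialSum, Nat.cast_inj]
    refine Nat.card_congr (Equiv.subtypeEquivRight fun i => ?_)
    rw [← (add_tsub_cancel_of_le h), add_right_inj, add_tsub_cancel_of_le h]
  · have : IsEmpty {i // n + a i = m} := ⟨fun i => h (i.2 ▸ le_self_add)⟩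
    simp

/-- The hypothesis on finite fibers matters: `Nat.card` of an infinite fiber is zero. -/
theorem prod_monomialSum {R : Type*} [Fintype R] {ι : R → Type*} (a : ∀ r, ι r → ℤ →₀ ℕ)
    (hfin : ∀ r m, Finite {i // a r i = m}) :
    ∏ r, monomialSum (a r) = monomialSum fun y : ∀ r, ι r => ∑ r, a r (y r) := by
  classical
  ext m
  rw [coeff_prod, coeff_monomialSum]
  simp only [coeff_monomialSum]
  rw [← Finset.sum_coe_sort]
  simp only [← Nat.cast_prod, ← Nat.card_pi, ← Nat.cast_sum]
  rw [← Nat.card_sigma, Nat.cast_inj]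
  refine Nat.card_congr
    { toFun := fun x => ⟨fun r => (x.2 r).1, ?_⟩
      invFun := fun y => ⟨⟨Finsupp.equivFunOnFinite.symm fun r => a r (y.1 r), ?_⟩,
        fun r => ⟨y.1 r, rfl⟩⟩
      left_inv := ?_
      right_inv := fun y => rfl }
  · have := (Finset.mem_finsuppAntidiag.1 x.1.2).1
    simp only [(x.2 _).2]
    exact this
  · rw [Finset.mem_finsuppAntidiag]
    exact ⟨y.2, Finset.subset_univ _⟩
  · rintro ⟨⟨l, hl⟩, x⟩
    suffices ∀ y : ∀ r, ι r, (∀ r, (x r).1 = y r) → ∀ hy,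
        (⟨⟨Finsupp.equivFunOnFinite.symm fun r => a r (y r), hy⟩, fun r => ⟨y r, rfl⟩⟩ :
          Σ l : ↥(Finset.univ.finsuppAntidiag m), ∀ r, {i // a r i = l.1 r}) = ⟨⟨l, hl⟩, x⟩ from
      this _ (fun _ => rfl) _
    intro y hxy hy
    have hl' : l = Finsupp.equivFunOnFinite.symm fun r => a r (y r) := by
      ext1 r
      rw [← (x r).2, hxy r]
      rfl
    subst hl'
    congr 1
    exact funext fun r => Subtype.ext (hxy r).symm

theorem finite_pB_fiber {a b : ℕ} (ha : 1 ≤ a) (m : ℤ →₀ ℕ) :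
    Finite {i : ℤ // Finsupp.single i a + Finsupp.single (-i) b = m} := by
  refine Set.Finite.subset m.support.finite_toSet (s := {i | _}) ?_
  rintro i rfl
  refine Finset.mem_coe.2 (Finsupp.mem_support_iff.2 ?_)
  rw [Finsupp.add_apply, Finsupp.single_eq_same]
  omega

end MonomialSum

namespace SignedPartition

variable {V : Type*} [Fintype V] (P : SignedPartition V)

theorem content_eq (κ : V → ℤ) (h : ∀ v, κ v = P.sign v * κ (P.rep v)) :
    ∑ v, Finsupp.single (κ v) 1 = Finsupp.single 0 P.zeros.card +
      ∑ r : P.roots, (Finsupp.single (κ r) (P.part 1 r).card +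
        Finsupp.single (-κ r) (P.part (-1) r).card) := by
  rw [P.sum_eq_sum_parts, ← Finset.sum_coe_sort P.roots]
  congr 1
  · rw [Finset.sum_congr rfl fun v hv => by rw [h v, mem_zeros.1 hv, zero_mul], Finset.sum_const,
      Finsupp.smul_single]
    simp
  · refine Finset.sum_congr rfl fun r _ => ?_
    congr 1
    · rw [Finset.sum_congr rfl fun v hv => by
        rw [h v, (mem_part.1 hv).1, (mem_part.1 hv).2, one_mul], Finset.sum_const,
        Finsupp.smul_single]
      simp
    · rw [Finset.sum_congr rfl fun v hv => by
        rw [h v, (mem_part.1 hv).1, (mem_part.1 hv).2, neg_one_mul], Finset.sum_const,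
        Finsupp.smul_single]
      simp

/-- A coloring compatible with the partition is a free choice of colors for the representatives. -/
theorem monomialSum_eq :
    monomialSum (fun κ : {κ : V → ℤ // ∀ v, κ v = P.sign v * κ (P.rep v)} =>
      ∑ v, Finsupp.single (κ.1 v) 1) =
    MvPowerSeries.X 0 ^ P.zeros.card *
      ∏ r ∈ P.roots, pB (P.part 1 r).card (P.part (-1) r).card := by
  classical
  rw [MvPowerSeries.X_pow_eq, ← Finset.prod_coe_sort P.roots]
  simp only [pB]
  rw [prod_monomialSum _ fun r => finite_pB_fiber (P.one_le_card_part r.2),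
    ← monomialSum_const_add]
  let e : {κ : V → ℤ // ∀ v, κ v = P.sign v * κ (P.rep v)} ≃ (P.roots → ℤ) :=
    { toFun := fun κ r => κ.1 r
      invFun := fun y =>
        ⟨fun v => P.sign v * if h : P.rep v ∈ P.roots then y ⟨P.rep v, h⟩ else 0, fun v => by
          by_cases hs : P.sign v = 0
          · simp [hs]
          · simp only [P.sign_rep v hs, P.rep_rep v hs, one_mul]⟩
      left_inv := fun κ => Subtype.ext (funext fun v => by
        by_cases hs : P.sign v = 0
        · have := κ.2 v
          rw [hs, zero_mul] at this
          simp [hs, this]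
        · simp only [rep_mem_roots hs, dite_true]
          exact (κ.2 v).symm)
      right_inv := fun y => funext fun r => by
        obtain ⟨h1, h2⟩ := mem_roots.1 r.2
        simp [h1, h2] }
  exact monomialSum_congr e fun κ => (P.content_eq κ.1 κ.2).symm

end SignedPartition

namespace SignedGraph

variable {V E : Type*} [Fintype V] (G : SignedGraph V E)

theorem finite_content_fiber (m : ℤ →₀ ℕ) :
    {κ : V → ℤ | ∑ v, Finsupp.single (κ v) 1 = m}.Finite := by
  refine Set.Finite.subset (Set.Finite.pi' fun _ : V => m.support.finite_toSet) ?_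
  rintro κ rfl v
  simp only [SetLike.mem_coe, Finsupp.mem_support_iff, Finsupp.finsetSum_apply]
  have := Finset.single_le_sum (f := fun u => Finsupp.single (κ u) (1 : ℕ) (κ v))
    (fun _ _ => Nat.zero_le _) (Finset.mem_univ v)
  simp only [Finsupp.single_eq_same] at this
  omega

open Classical in
theorem card_content_fiber (p : (V → ℤ) → Prop) (m : ℤ →₀ ℕ) :
    (Nat.card {κ : {κ : V → ℤ // p κ} // ∑ v, Finsupp.single (κ.1 v) 1 = m} : ℚ) =
      ∑ κ ∈ (finite_content_fiber m).toFinset, if p κ then (1 : ℚ) else 0 := by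
  rw [Finset.sum_boole, Nat.cast_inj,
    Nat.card_congr (Equiv.subtypeSubtypeEquivSubtypeInter p
      fun κ : V → ℤ => ∑ v, Finsupp.single (κ v) 1 = m)]
  refine Nat.subtype_card _ fun κ => ?_
  simp [and_comm]

open Classical in
/-- Inclusion and exclusion over the set of violated edges. -/
theorem chromaticB_eq_sum [Fintype E] : G.chromaticB = ∑ S : Finset E, (-1) ^ S.card *
    monomialSum (fun κ : {κ : V → ℤ // ∀ e ∈ S, κ (G.ends e false) =
      (G.sgn e : ℤ) * κ (G.ends e true)} => ∑ v, Finsupp.single (κ.1 v) 1) := by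
  ext m
  rw [chromaticB, coeff_monomialSum, card_content_fiber, map_sum]
  have hS : ∀ S : Finset E, MvPowerSeries.coeff m ((-1) ^ S.card *
      monomialSum (fun κ : {κ : V → ℤ // ∀ e ∈ S, κ (G.ends e false) =
        (G.sgn e : ℤ) * κ (G.ends e true)} => ∑ v, Finsupp.single (κ.1 v) 1)) =
      ∑ κ ∈ (finite_content_fiber m).toFinset, if ∀ e ∈ S, κ (G.ends e false) =
        (G.sgn e : ℤ) * κ (G.ends e true) then (-1 : ℚ) ^ S.card else 0 := by
    intro S
    have : ((-1) ^ S.card : MvPowerSeries ℤ ℚ) = MvPowerSeries.C ((-1 : ℚ) ^ S.card) := by simp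
    rw [this, MvPowerSeries.coeff_C_mul, coeff_monomialSum, card_content_fiber, Finset.mul_sum]
    simp
  simp only [hS]
  rw [Finset.sum_comm]
  refine Finset.sum_congr rfl fun κ _ => ?_
  let B : Finset E := Finset.univ.filter fun e =>
    κ (G.ends e false) = (G.sgn e : ℤ) * κ (G.ends e true)
  have h1 : G.IsProper κ ↔ B = ∅ := by
    simp [B, IsProper, Finset.filter_eq_empty_iff]
  have h2 : ∀ S : Finset E, (∀ e ∈ S, κ (G.ends e false) =
      (G.sgn e : ℤ) * κ (G.ends e true)) ↔ S ∈ B.powerset := by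
    intro S
    simp [B, Finset.subset_iff]
  have h3 := Finset.sum_powerset_neg_one_pow_card (x := B)
  simp only [h1, h2]
  rw [← Finset.sum_filter, Finset.filter_univ_mem]
  exact_mod_cast h3.symm

/-- As the sign pattern of a partition is integral, the integer colorings in a flat are described by
the same partition as the rational vectors in it. -/
theorem exists_partition_int (S : Finset E) : ∃ P : SignedPartition V, P.space = G.flat S ∧
    monomialSum (fun κ : {κ : V → ℤ // ∀ e ∈ S, κ (G.ends e false) =
      (G.sgn e : ℤ) * κ (G.ends e true)} => ∑ v, Finsupp.single (κ.1 v) 1) =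
    MvPowerSeries.X 0 ^ P.zeros.card *
      ∏ r ∈ P.roots, pB (P.part 1 r).card (P.part (-1) r).card := by
  obtain ⟨P, hP⟩ := G.exists_partition S
  refine ⟨P, hP, ?_⟩
  rw [← P.monomialSum_eq]
  refine monomialSum_congr (Equiv.subtypeEquivRight fun κ => ?_) fun κ => rfl
  have h1 := mem_flat (G := G) (S := S) (κ := fun v => (κ v : ℚ))
  rw [← hP, P.mem_space] at h1
  exact_mod_cast h1.symm

end SignedGraph

section SinkWeight

open Polynomial

/-- The ring homomorphism `ξ_n ↦ X ^ n`, `q_{a,b} ↦ 1`, `z ↦ 1`; the coefficient of `X ^ k` in the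
image of a polynomial is the sum of the coefficients of its monomials with `ξ`-index sum `k`. -/
noncomputable def sinkWeight : MvPolynomial XiIndex ℚ →ₐ[ℚ] ℚ[X] :=
  MvPolynomial.aeval fun i => X ^ i.weight

theorem coeff_sinkWeight (f : MvPolynomial XiIndex ℚ) (k : ℕ) :
    (sinkWeight f).coeff k = ∑ m ∈ f.support with xiIndexSum m = k, f.coeff m := by
  have h : ∀ m : XiIndex →₀ ℕ, (m.prod fun i c => ((X : ℚ[X]) ^ i.weight) ^ c) =
      X ^ xiIndexSum m := fun m => by
    simp only [← pow_mul, Finsupp.prod, xiIndexSum, Finsupp.sum, ← Finset.prod_pow_eq_pow_sum,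
      mul_comm]
  rw [sinkWeight, MvPolynomial.aeval_def, MvPolynomial.eval₂_eq, finsetSum_coeff,
    Finset.sum_filter]
  refine Finset.sum_congr rfl fun m _ => ?_
  have h' := h m
  rw [Finsupp.prod] at h'
  rw [h', ← Polynomial.C_eq_algebraMap, coeff_C_mul, coeff_X_pow]
  simp [eq_comm]

/-- The relation `ξ_a = ∑ (a choose i) p_{i,0}` is solved for `p_{a,0}`; it is satisfied by
`X ^ a` and `(X - 1) ^ i - (-1) ^ i` by the binomial theorem. -/
theorem exists_pB_zero (a : ℕ) (ha : 1 ≤ a) : ∃ f : MvPolynomial XiIndex ℚ,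
    MvPolynomial.aeval xiBasis f = pB a 0 ∧ sinkWeight f = (X - 1) ^ a - (-1) ^ a := by
  induction a using Nat.strong_induction_on with
  | _ a ih =>
    choose! f hf1 hf2 using ih
    have hxi : xiB a = pB a 0 +
        ∑ i ∈ Finset.Ico 1 a, (a.choose i : MvPowerSeries ℤ ℚ) * pB i 0 := by
      rw [xiB, ← Finset.Ico_insert_right ha, Finset.sum_insert (by simp)]
      simp
    refine ⟨MvPolynomial.X (.xi a ha) -
      ∑ i ∈ Finset.Ico 1 a, (a.choose i : MvPolynomial XiIndex ℚ) * f i, ?_, ?_⟩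
    · simp only [map_sub, map_sum, map_mul, map_natCast, MvPolynomial.aeval_X, xiBasis]
      rw [hxi, add_sub_assoc, ← Finset.sum_sub_distrib, Finset.sum_eq_zero, add_zero]
      intro i hi
      rw [Finset.mem_Ico] at hi
      rw [hf1 i hi.2 hi.1, sub_self]
    · have h1 : ∑ i ∈ Finset.range (a + 1), ((a.choose i : ℚ[X]) * (X - 1) ^ i) = X ^ a := by
        have := add_pow (X - 1 : ℚ[X]) 1 a
        rw [sub_add_cancel] at this
        rw [this]
        exact Finset.sum_congr rfl fun i _ => by ring
      have h2 : ∑ i ∈ Finset.range (a + 1), ((a.choose i : ℚ[X]) * (-1) ^ i) = 0 := by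
        have := add_pow (-1 : ℚ[X]) 1 a
        rw [neg_add_cancel, zero_pow (by omega)] at this
        rw [this]
        exact Finset.sum_congr rfl fun i _ => by ring
      have h3 : ∑ i ∈ Finset.Ico 1 a, ((a.choose i : ℚ[X]) * ((X - 1) ^ i - (-1) ^ i)) =
          X ^ a - ((X - 1) ^ a - (-1) ^ a) := by
        have key : ∑ i ∈ Finset.range (a + 1),
            ((a.choose i : ℚ[X]) * ((X - 1) ^ i - (-1) ^ i)) = X ^ a := by
          simp only [mul_sub, Finset.sum_sub_distrib, h1, h2, sub_zero]
        rw [Finset.sum_range_succ, Finset.range_eq_Ico, Finset.sum_eq_sum_Ico_succ_bot ha] at key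
        simp only [pow_zero, sub_self, mul_zero, zero_add, Nat.choose_self, Nat.cast_one,
          one_mul] at key
        linear_combination key
      simp only [map_sub, map_sum, map_mul, map_natCast]
      rw [Finset.sum_congr rfl fun i hi => by
        rw [hf2 i (Finset.mem_Ico.1 hi).2 (Finset.mem_Ico.1 hi).1], h3]
      simp [sinkWeight, XiIndex.weight]

theorem exists_pB (a b : ℕ) (ha : 1 ≤ a) : ∃ f : MvPolynomial XiIndex ℚ,
    MvPolynomial.aeval xiBasis f = pB a b ∧
      sinkWeight f = (if b = 0 then (X - 1) ^ a else 0) - (-1) ^ (a + b) := by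
  have hq : ∀ c d, (-1) ^ (c + d + 1) * qB c d = pB c d := fun c d => by
    rw [qB, ← mul_assoc, ← mul_pow]
    simp
  rcases Nat.eq_zero_or_pos b with rfl | hb
  · simpa using exists_pB_zero a ha
  rcases le_total b a with h | h
  · refine ⟨(-1) ^ (a + b + 1) * MvPolynomial.X (.q a b hb h), ?_, ?_⟩
    · simp [xiBasis, hq]
    · simp [sinkWeight, XiIndex.weight, hb.ne', pow_succ]
  · refine ⟨(-1) ^ (b + a + 1) * MvPolynomial.X (.q b a ha h), ?_, ?_⟩
    · simp [xiBasis, hq, pB_comm a b]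
    · simp [sinkWeight, XiIndex.weight, hb.ne', pow_succ, add_comm a b]

end SinkWeight

/-! ### The sum over sets of sinks -/

namespace SignedGraph

variable {V E : Type*} [Fintype V] [Fintype E] (G : SignedGraph V E)

/-- The case of the partition into single vertices of `finrank_space_inf_vanishing`. -/
theorem finrank_vanishing (W : Finset V) :
    Module.finrank ℚ (vanishing W) + W.card = Fintype.card V := by
  classical
  let P : SignedPartition V := ⟨id, fun _ => 1, by simp, by simp, by simp⟩
  have h1 : P.space = ⊤ := by
    ext κ
    simp [P, SignedPartition.mem_space]
  have h2 : P.block W = W := by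
    ext v
    simp [P, SignedPartition.mem_block]
  have h3 : P.roots = Finset.univ := by
    ext v
    simp [P, SignedPartition.mem_roots]
  have h := P.finrank_space_inf_vanishing W
  rw [h1, h2, h3, top_inf_eq] at h
  rw [h, Finset.card_sdiff_add_card_eq_card (Finset.subset_univ W), Finset.card_univ]

omit [Fintype V] in
theorem indic_mem_flat {W : Finset V} {S : Finset E} :
    indic W ∈ G.flat S ↔ S ∈ (G.evenEdges W).powerset := by
  simp [flat, evenEdges, Finset.subset_iff]

open Polynomial in
open Classical in
/-- An expansion of the chromatic `B`-symmetric function, and its image under `sinkWeight`: for each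
`W` the edge sets `S` with `indic W ∈ G.flat S` are summed by Zaslavsky's formula. -/
theorem exists_expansion : ∃ f : MvPolynomial XiIndex ℚ,
    MvPolynomial.aeval xiBasis f = G.chromaticB ∧
      sinkWeight f = ∑ W : Finset V, (X - 1) ^ W.card *
        (regionCount G.edgeForm (vanishing W) (G.evenEdges W) : ℚ[X]) := by
  choose P hP1 hP2 using G.exists_partition_int
  choose! g hg1 hg2 using exists_pB
  refine ⟨∑ S : Finset E, (-1) ^ S.card * ((-MvPolynomial.X .z) ^ (P S).zeros.card *
    ∏ r ∈ (P S).roots, g ((P S).part 1 r).card ((P S).part (-1) r).card), ?_, ?_⟩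
  · rw [chromaticB_eq_sum, map_sum]
    refine Finset.sum_congr rfl fun S _ => ?_
    rw [hP2]
    simp only [map_mul, map_pow, map_neg, map_one, map_prod, MvPolynomial.aeval_X, xiBasis, zB,
      neg_neg]
    rw [Finset.prod_congr rfl fun r hr => hg1 _ _ ((P S).one_le_card_part hr)]
  · have hS : ∀ S : Finset E, sinkWeight ((-1) ^ S.card *
        ((-MvPolynomial.X .z) ^ (P S).zeros.card *
          ∏ r ∈ (P S).roots, g ((P S).part 1 r).card ((P S).part (-1) r).card)) =
        ∑ W : Finset V, if S ∈ (G.evenEdges W).powerset then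
          ((X : ℚ[X]) - 1) ^ W.card * (-1) ^ (Fintype.card V + W.card) * C ((-1) ^ S.card *
            (-1) ^ Module.finrank ℚ ↥(vanishing W ⊓ ⨅ e ∈ S, LinearMap.ker (G.edgeForm e)))
        else 0 := by
      intro S
      have hz : sinkWeight (MvPolynomial.X .z) = 1 := by simp [sinkWeight, XiIndex.weight]
      simp only [map_mul, map_pow, map_neg, map_one, map_prod, hz]
      rw [Finset.prod_congr rfl fun r hr => hg2 _ _ ((P S).one_le_card_part hr),
        (P S).prod_roots_eq_sum, hP1, Finset.mul_sum]
      refine Finset.sum_congr rfl fun W _ => ?_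
      have hinf : Module.finrank ℚ ↥(G.flat S ⊓ vanishing W) =
          Module.finrank ℚ ↥(vanishing W ⊓ ⨅ e ∈ S, LinearMap.ker (G.edgeForm e)) := by
        rw [inf_comm]
        rfl
      simp only [G.indic_mem_flat, hinf]
      split_ifs
      · ring
      · rw [mul_zero]
    rw [map_sum, Finset.sum_congr rfl fun S _ => hS S, Finset.sum_comm]
    refine Finset.sum_congr rfl fun W _ => ?_
    have h := sum_powerset_neg_one_pow_finrank G.edgeForm (G.evenEdges W) (vanishing W)
    rw [← Finset.sum_filter, Finset.filter_univ_mem, ← Finset.mul_sum, ← map_sum]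
    rw [h, ← finrank_vanishing W]
    simp only [map_mul, map_pow, map_neg, map_one, map_natCast]
    have : ((-1 : ℚ[X]) ^ (Module.finrank ℚ ↥(vanishing W) + W.card + W.card)) *
        (-1) ^ Module.finrank ℚ ↥(vanishing W) = 1 := by
      rw [← pow_add]
      exact Even.neg_one_pow ⟨Module.finrank ℚ ↥(vanishing W) + W.card, by ring⟩
    linear_combination ((X : ℚ[X]) - 1) ^ W.card *
      (regionCount G.edgeForm (vanishing W) (G.evenEdges W) : ℚ[X]) * this

open Polynomial in
open Classical in
/-- Both sides count pairs of an acyclic orientation and a set of its sinks. -/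
theorem sum_regionCount : ∑ W : Finset V, ((X : ℚ[X]) - 1) ^ W.card *
      (regionCount G.edgeForm (vanishing W) (G.evenEdges W) : ℚ[X]) =
    ∑ τ : E → Bool → Bool with G.IsOrientation τ ∧ G.IsAcyclic τ,
      X ^ {v | G.IsSink τ v}.ncard := by
  have h1 : ∀ τ : E → Bool → Bool, (X : ℚ[X]) ^ {v | G.IsSink τ v}.ncard =
      ∑ W : Finset V, if ∀ v ∈ W, G.IsSink τ v then (X - 1) ^ W.card else 0 := by
    intro τ
    have hs : {v | G.IsSink τ v} =
        ((Finset.univ.filter fun v => G.IsSink τ v : Finset V) : Set V) := by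
      ext; simp
    rw [hs, Set.ncard_coe_finset]
    have := Finset.sum_pow_mul_eq_add_pow ((X : ℚ[X]) - 1) 1
      (Finset.univ.filter fun v => G.IsSink τ v)
    rw [sub_add_cancel] at this
    rw [← this, ← Finset.sum_filter]
    refine Finset.sum_congr ?_ fun W _ => by rw [one_pow, mul_one]
    ext W
    simp [Finset.subset_iff]
  simp only [h1]
  rw [Finset.sum_comm]
  refine Finset.sum_congr rfl fun W _ => ?_
  rw [← card_acyclic_sinks, ← Finset.sum_filter, Finset.filter_filter, Finset.sum_const,
    nsmul_eq_mul, mul_comm]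

open Polynomial in
theorem coeff_sum_sinks (k : ℕ) : (∑ W : Finset V, ((X : ℚ[X]) - 1) ^ W.card *
      (regionCount G.edgeForm (vanishing W) (G.evenEdges W) : ℚ[X])).coeff k =
    G.acyclicCount k := by
  classical
  rw [sum_regionCount, finsetSum_coeff]
  simp only [coeff_X_pow]
  rw [Finset.sum_boole, Finset.filter_filter, acyclicCount, ← Set.ncard_coe_finset]
  congr 2
  ext τ
  simp [and_assoc, eq_comm]

end SignedGraph

/-! ### Algebraic independence -/

section Independence

open MvPowerSeries

/-- Setting the variables outside `s` to zero. -/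
noncomputable def restrictVars (s : Finset ℤ) : MvPowerSeries ℤ ℚ →ₐ[ℚ] MvPowerSeries ℤ ℚ :=
  AlgHom.ofLinearMap
    { toFun := fun f m => if m.support ⊆ s then coeff m f else 0
      map_add' := fun f g => by
        ext m
        simp only [map_add]
        change (if m.support ⊆ s then coeff m f + coeff m g else 0) =
          (if m.support ⊆ s then coeff m f else 0) + (if m.support ⊆ s then coeff m g else 0)
        split_ifs <;> simp
      map_smul' := fun c f => by
        ext m
        change (if m.support ⊆ s then c * coeff m f else 0) =
          c * (if m.support ⊆ s then coeff m f else 0)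
        split_ifs <;> simp }
    (by
      ext m
      change (if m.support ⊆ s then coeff m (1 : MvPowerSeries ℤ ℚ) else 0) = _
      classical
      rw [coeff_one]
      split_ifs with h1 h2 h3 <;> simp_all)
    (fun f g => by
      ext m
      change (if m.support ⊆ s then coeff m (f * g) else 0) = _
      classical
      rw [coeff_mul, coeff_mul]
      change _ = ∑ p ∈ Finset.HasAntidiagonal.antidiagonal m,
        (if p.1.support ⊆ s then coeff p.1 f else 0) *
        (if p.2.support ⊆ s then coeff p.2 g else 0)
      have : ∀ p ∈ Finset.HasAntidiagonal.antidiagonal m,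
          m.support ⊆ s ↔ p.1.support ⊆ s ∧ p.2.support ⊆ s := by
        intro p hp
        rw [← Finset.HasAntidiagonal.mem_antidiagonal.1 hp, ← Finset.union_subset_iff]
        congr! 1
        ext i
        simp only [Finsupp.mem_support_iff, Finset.mem_union, Finsupp.add_apply]
        omega
      split_ifs with h
      · refine Finset.sum_congr rfl fun p hp => ?_
        rw [if_pos ((this p hp).1 h).1, if_pos ((this p hp).1 h).2]
      · refine (Finset.sum_eq_zero fun p hp => ?_).symm
        by_cases h1 : p.1.support ⊆ s
        · rw [if_neg (fun h2 => h ((this p hp).2 ⟨h1, h2⟩)), mul_zero]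
        · rw [if_neg h1, zero_mul])

theorem coeff_restrictVars (s : Finset ℤ) (f : MvPowerSeries ℤ ℚ) (m : ℤ →₀ ℕ) :
    coeff m (restrictVars s f) = if m.support ⊆ s then coeff m f else 0 := rfl

theorem restrictVars_X {s : Finset ℤ} {i : ℤ} (hi : i ∈ s) :
    restrictVars s (X i) = X i := by
  classical
  ext m
  rw [coeff_restrictVars, coeff_X]
  split_ifs with h1 h2 h2
  · rfl
  · rfl
  · subst h2
    exact absurd (Finsupp.support_single_subset.trans (by simpa using hi)) h1
  · rfl

theorem restrictVars_pB {s : Finset ℤ} (hs : ∀ i ∈ s, -i ∈ s) {a b : ℕ} (ha : 1 ≤ a) :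
    restrictVars s (pB a b) = ∑ i ∈ s, X i ^ a * X (-i) ^ b := by
  classical
  ext m
  rw [coeff_restrictVars, map_sum, pB, coeff_monomialSum]
  have h1 : ∀ i : ℤ, coeff m (X i ^ a * X (-i) ^ b : MvPowerSeries ℤ ℚ) =
      if Finsupp.single i a + Finsupp.single (-i) b = m then 1 else 0 := by
    intro i
    rw [X_pow_eq, X_pow_eq, monomial_mul_monomial, coeff_monomial, one_mul]
    simp only [eq_comm]
  simp only [h1]
  rw [Finset.sum_boole]
  have h2 : ∀ i : ℤ, (Finsupp.single i a + Finsupp.single (-i) b).support ⊆ s ↔ i ∈ s := by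
    intro i
    constructor
    · intro h
      refine h (Finsupp.mem_support_iff.2 ?_)
      rw [Finsupp.add_apply, Finsupp.single_eq_same]
      omega
    · intro h
      refine Finsupp.support_add.trans (Finset.union_subset ?_ ?_)
      · exact Finsupp.support_single_subset.trans (by simpa using h)
      · exact Finsupp.support_single_subset.trans (by simpa using hs i h)
  split_ifs with h
  · rw [Nat.cast_inj]
    refine Nat.subtype_card _ fun i => ?_
    rw [Finset.mem_filter]
    constructor
    · exact fun h => h.2
    · rintro rfl
      exact ⟨(h2 i).1 h, rfl⟩
  · rw [Finset.filter_eq_empty_iff.2, Finset.card_empty, Nat.cast_zero]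
    rintro i hi rfl
    exact h ((h2 i).2 hi)

/-- The contribution of a color with value `x`, whose opposite color has value `y`, to the
generators `ξ_n` and `q_{a,b}`. -/
def colorTerm {A : Type*} [CommRing A] (x y : A) : XiIndex → A
  | .xi n _ => (1 + x) ^ n - 1
  | .q a b _ _ => (-1) ^ (a + b + 1) * (x ^ a * y ^ b)
  | .z => 0

/-- The values of the generators when the color `i` has the value `α i` for `i ∈ s`, and the value
`0` for `i ∉ s`; here `s` should be symmetric and contain `0`. -/
def genValue {A : Type*} [CommRing A] (s : Finset ℤ) (α : ℤ → A) : XiIndex → A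
  | .z => -α 0
  | .xi n hn => ∑ j ∈ s, colorTerm (α j) (α (-j)) (.xi n hn)
  | .q a b hb hab => ∑ j ∈ s, colorTerm (α j) (α (-j)) (.q a b hb hab)

theorem map_genValue {A B : Type*} [CommRing A] [CommRing B] [Algebra ℚ A] [Algebra ℚ B]
    (φ : A →ₐ[ℚ] B) (s : Finset ℤ) (α : ℤ → A) (i : XiIndex) :
    φ (genValue s α i) = genValue s (fun j => φ (α j)) i := by
  cases i <;> simp [genValue, colorTerm]

theorem restrictVars_xiBasis {s : Finset ℤ} (hs : ∀ i ∈ s, -i ∈ s) (h0 : 0 ∈ s) (i : XiIndex) :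
    restrictVars s (xiBasis i) = genValue s X i := by
  cases i with
  | z => simp [xiBasis, zB, genValue, restrictVars_X h0]
  | q a b hb hab =>
    simp only [xiBasis, qB, genValue, colorTerm, map_mul, map_pow, map_neg, map_one,
      restrictVars_pB hs (hb.trans hab), Finset.mul_sum]
  | xi n hn =>
    simp only [xiBasis, xiB, genValue, colorTerm, map_sum, map_mul, map_natCast]
    rw [Finset.sum_congr rfl fun a ha => by
      rw [restrictVars_pB hs (Finset.mem_Icc.1 ha).1, Finset.mul_sum], Finset.sum_comm]
    refine Finset.sum_congr rfl fun j _ => ?_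
    have h := add_pow (X j : MvPowerSeries ℤ ℚ) 1 n
    rw [Finset.range_eq_Ico, Finset.sum_eq_sum_Ico_succ_bot (Nat.succ_pos n)] at h
    rw [add_comm, h]
    simp only [pow_zero, one_pow, mul_one, Nat.choose_zero_right, Nat.cast_one,
      add_sub_cancel_left]
    exact Finset.sum_congr rfl fun a _ => mul_comm _ _

/-- An algebraic relation between the power series holds for the values of the generators on every
finite alphabet. -/
theorem aeval_genValue_eq_zero {F : MvPolynomial XiIndex ℚ}
    (hF : MvPolynomial.aeval xiBasis F = 0) {s : Finset ℤ} (hs : ∀ i ∈ s, -i ∈ s) (h0 : 0 ∈ s)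
    (α : ℤ → ℚ) : MvPolynomial.eval (genValue s α) F = 0 := by
  have h1 : MvPolynomial.aeval (genValue s (X : ℤ → MvPowerSeries ℤ ℚ)) F = 0 := by
    have := congrArg (restrictVars s) hF
    rw [map_zero, MvPolynomial.comp_aeval_apply] at this
    simpa only [restrictVars_xiBasis hs h0] using this
  have h2 : MvPolynomial.aeval (genValue s (MvPolynomial.X : ℤ → MvPolynomial ℤ ℚ)) F = 0 := by
    apply MvPolynomial.coe_injective ℤ ℚ
    have h3 := MvPolynomial.comp_aeval_apply (genValue s (MvPolynomial.X : ℤ → MvPolynomial ℤ ℚ))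
      (MvPolynomial.coeToMvPowerSeries.algHom (σ := ℤ) (R := ℚ) ℚ) F
    simp only [map_genValue] at h3
    have hX : ∀ j, MvPolynomial.coeToMvPowerSeries.algHom ℚ (MvPolynomial.X j : MvPolynomial ℤ ℚ) =
        (X j : MvPowerSeries ℤ ℚ) := fun j => by simp
    simp only [hX] at h3
    rw [h1] at h3
    exact h3
  have h3 := MvPolynomial.comp_aeval_apply (genValue s (MvPolynomial.X : ℤ → MvPolynomial ℤ ℚ))
      (MvPolynomial.aeval α) F
  simp only [map_genValue, MvPolynomial.aeval_X, h2, map_zero] at h3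
  rw [← MvPolynomial.coe_aeval_eq_eval]
  exact h3.symm

/-- A polynomial that vanishes on a translate of an additive monoid vanishes on the translate of the
linear span: along each direction it has infinitely many zeros. -/
theorem eval_add_eq_zero_of_mem_span {σ : Type*} {D : Set (σ → ℚ)} {F : MvPolynomial σ ℚ}
    {w : σ → ℚ} (hw : w ∈ Submodule.span ℚ D) : ∀ u : σ → ℚ,
      (∀ d ∈ AddSubmonoid.closure D, MvPolynomial.eval (u + d) F = 0) →
      ∀ d ∈ AddSubmonoid.closure D, MvPolynomial.eval (u + w + d) F = 0 := by
  induction hw using Submodule.span_induction with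
  | mem x hx =>
    intro u h d hd
    rw [add_assoc]
    exact h _ (add_mem (AddSubmonoid.subset_closure hx) hd)
  | zero => simp
  | add x y _ _ hx hy =>
    intro u h
    rw [← add_assoc]
    exact hy _ (hx u h)
  | smul c x _ hx =>
    intro u h
    have hnat : ∀ k : ℕ, ∀ d ∈ AddSubmonoid.closure D,
        MvPolynomial.eval (u + (k : ℚ) • x + d) F = 0 := by
      intro k
      induction k with
      | zero => simpa using h
      | succ k ih =>
        have := hx _ ih
        simpa only [Nat.cast_succ, add_smul, one_smul, add_assoc] using this
    intro d hd
    let p : Polynomial ℚ := MvPolynomial.aeval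
      (fun i => Polynomial.C (u i + d i) + Polynomial.C (x i) * Polynomial.X) F
    have hp : ∀ t : ℚ, p.eval t = MvPolynomial.eval (u + t • x + d) F := by
      intro t
      have := MvPolynomial.comp_aeval_apply
        (fun i => Polynomial.C (u i + d i) + Polynomial.C (x i) * Polynomial.X)
        (Polynomial.aeval t) F
      rw [← Polynomial.coe_aeval_eq_eval, ← MvPolynomial.coe_aeval_eq_eval]
      have hfun : (fun i => Polynomial.aeval t (Polynomial.C (u i + d i) +
          Polynomial.C (x i) * Polynomial.X)) = u + t • x + d := by
        funext i
        simp
        ring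
      rw [hfun] at this
      exact this
    have h0 : p = 0 := Polynomial.eq_zero_of_infinite_isRoot p <|
      (Set.infinite_range_of_injective (Nat.cast_injective (R := ℚ))).mono <| by
        rintro _ ⟨k, rfl⟩
        exact (hp k).trans (hnat k d hd)
    rw [← hp, h0, Polynomial.eval_zero]

/-- The contribution of a pair of nonzero opposite colors with values `x` and `y`. -/
def pairTerm (x y : ℚ) : XiIndex → ℚ := colorTerm x y + colorTerm y x

/-- An alphabet can be enlarged by any pair of opposite colors. -/
theorem exists_genValue (c : ℚ) {d : XiIndex → ℚ}
    (hd : d ∈ AddSubmonoid.closure (Set.range fun p : ℚ × ℚ => pairTerm p.1 p.2)) :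
    ∃ (s : Finset ℤ) (α : ℤ → ℚ), (∀ i ∈ s, -i ∈ s) ∧ 0 ∈ s ∧
      genValue s α = genValue {0} (fun _ => c) + d := by
  induction hd using AddSubmonoid.closure_induction_left with
  | zero => exact ⟨{0}, fun _ => c, by simp, by simp, by simp⟩
  | add_left p hp d _ ih =>
    obtain ⟨⟨x, y⟩, rfl⟩ := hp
    obtain ⟨s, α, hs, h0, hα⟩ := ih
    obtain ⟨m, hm⟩ := Infinite.exists_notMem_finset s
    have hm0 : m ≠ 0 := fun h => hm (h ▸ h0)
    have hm' : -m ∉ s := fun h => hm (by simpa using hs _ h)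
    have hmm : m ≠ -m := by omega
    let β : ℤ → ℚ := fun j => if j = m then x else if j = -m then y else α j
    have hβ1 : β m = x := if_pos rfl
    have hβ2 : β (-m) = y := by simp [β, hmm.symm]
    have hβ : ∀ j ∈ s, β j = α j := fun j hj => by
      have h1 : j ≠ m := fun h => hm (h ▸ hj)
      have h2 : j ≠ -m := fun h => hm' (h ▸ hj)
      simp [β, h1, h2]
    refine ⟨insert m (insert (-m) s), β, ?_, by simp [h0], ?_⟩
    · intro i hi
      simp only [Finset.mem_insert] at hi ⊢
      rcases hi with rfl | rfl | hi
      · simp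
      · simp
      · exact Or.inr (Or.inr (hs i hi))
    · have hsum : ∀ i, ∑ j ∈ insert m (insert (-m) s), colorTerm (β j) (β (-j)) i =
          pairTerm x y i + ∑ j ∈ s, colorTerm (α j) (α (-j)) i := by
        intro i
        rw [Finset.sum_insert (by simp [hmm, hm]), Finset.sum_insert hm', hβ1, hβ2, neg_neg, hβ1,
          Finset.sum_congr rfl fun j hj => by rw [hβ j hj, hβ _ (hs j hj)]]
        simp only [pairTerm, Pi.add_apply]
        ring
      rw [add_left_comm, ← hα]
      funext i
      cases i with
      | z => simp [genValue, pairTerm, colorTerm, hβ 0 h0]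
      | xi n hn => exact hsum _
      | q a b hb hab => exact hsum _

/-- With `y = 0` only the `ξ_n` remain, and `(1 + x) ^ n - 1` are linearly independent; then the
polynomials `x ^ a y ^ b + y ^ a x ^ b` are. -/
theorem eq_zero_of_sum_mul_pairTerm {T : Finset XiIndex} {c : XiIndex → ℚ}
    (h : ∀ x y, ∑ i ∈ T, c i * pairTerm x y i = 0) {i : XiIndex} (hi : i ∈ T) (hz : i ≠ .z) :
    c i = 0 := by
  classical
  have hxi : ∀ n hn, XiIndex.xi n hn ∈ T → c (.xi n hn) = 0 := by
    intro n hn hmem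
    let t : XiIndex → Polynomial ℚ
      | .xi k _ => Polynomial.X ^ k - 1
      | _ => 0
    have hp : ∑ i ∈ T, Polynomial.C (c i) * t i = 0 := by
      refine Polynomial.funext fun x => ?_
      rw [Polynomial.eval_finsetSum, Polynomial.eval_zero, ← h (x - 1) 0]
      refine Finset.sum_congr rfl fun i _ => ?_
      rw [Polynomial.eval_mul, Polynomial.eval_C]
      cases i with
      | xi k hk => simp [t, pairTerm, colorTerm]
      | z => simp [t, pairTerm, colorTerm]
      | q a b hb hab =>
        have ha : a ≠ 0 := by omega
        have hb : b ≠ 0 := by omega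
        simp [t, pairTerm, colorTerm, ha, hb]
    have hc := congrArg (fun p => Polynomial.coeff p n) hp
    simp only [Polynomial.finsetSum_coeff, Polynomial.coeff_C_mul, Polynomial.coeff_zero] at hc
    rw [Finset.sum_eq_single_of_mem _ hmem] at hc
    · simpa [t, Polynomial.coeff_one, show n ≠ 0 by omega] using hc
    · rintro (⟨k, hk⟩ | _ | _) _ hne
      · have hkn : n ≠ k := by rintro rfl; exact hne rfl
        simp [t, Polynomial.coeff_X_pow, Polynomial.coeff_one, hkn, show n ≠ 0 by omega]
      · simp [t]
      · simp [t]
  cases i with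
  | z => exact absurd rfl hz
  | xi n hn => exact hxi n hn hi
  | q a b hb hab =>
    let e : ℕ → ℕ → (Fin 2 →₀ ℕ) := fun a b => Finsupp.single 0 a + Finsupp.single 1 b
    have he : ∀ a b a' b', e a b = e a' b' ↔ a = a' ∧ b = b' := by
      intro a b a' b'
      constructor
      · intro h
        have h0 := DFunLike.congr_fun h 0
        have h1 := DFunLike.congr_fun h 1
        simp [e] at h0 h1
        exact ⟨h0, h1⟩
      · rintro ⟨rfl, rfl⟩; rfl
    let t : XiIndex → MvPolynomial (Fin 2) ℚ
      | .q a b _ _ => MvPolynomial.C ((-1) ^ (a + b + 1)) *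
          (MvPolynomial.monomial (e a b) 1 + MvPolynomial.monomial (e b a) 1)
      | _ => 0
    have hp : ∑ i ∈ T, MvPolynomial.C (c i) * t i = 0 := by
      refine MvPolynomial.funext fun x => ?_
      rw [map_sum, map_zero, ← h (x 0) (x 1)]
      refine Finset.sum_congr rfl fun i hi => ?_
      rw [map_mul, MvPolynomial.eval_C]
      cases i with
      | xi k hk => simp [hxi k hk hi]
      | z => simp [t, pairTerm, colorTerm]
      | q a b hb hab =>
        simp [t, pairTerm, colorTerm, e, MvPolynomial.eval_monomial, Finsupp.prod_add_index',
          pow_add, -mul_eq_mul_left_iff]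
        ring
    have hc := congrArg (MvPolynomial.coeff (e a b)) hp
    simp only [MvPolynomial.coeff_sum, MvPolynomial.coeff_C_mul, MvPolynomial.coeff_zero] at hc
    rw [Finset.sum_eq_single_of_mem _ hi] at hc
    · simp only [t, MvPolynomial.coeff_C_mul, MvPolynomial.coeff_add,
        MvPolynomial.coeff_monomial, he] at hc
      have h1 : ((-1 : ℚ) ^ (a + b + 1)) ≠ 0 := pow_ne_zero _ (by norm_num)
      rcases mul_eq_zero.1 hc with hc | hc
      · exact hc
      · exfalso
        rcases mul_eq_zero.1 hc with hc | hc
        · exact h1 hc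
        · simp only [if_true] at hc
          split_ifs at hc <;> norm_num at hc
    · rintro (_ | ⟨a', b', hb', hab'⟩ | _) _ hne
      · simp [t]
      · have hn : ¬ (a' = a ∧ b' = b) := by rintro ⟨rfl, rfl⟩; exact hne rfl
        have hn' : ¬ (b' = a ∧ a' = b) := by
          rintro ⟨rfl, rfl⟩
          obtain rfl : b' = a' := by omega
          exact hne rfl
        simp only [t, MvPolynomial.coeff_C_mul, MvPolynomial.coeff_add,
          MvPolynomial.coeff_monomial, he, hn, hn', if_false, add_zero, mul_zero]
      · simp [t]

/-- The contributions of pairs of colors span all vectors with `z`-coordinate zero, up to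
coordinates outside a finite set. -/
theorem exists_mem_span_pairTerm (T : Finset XiIndex) {w : XiIndex → ℚ} (hw : w .z = 0) :
    ∃ w' ∈ Submodule.span ℚ (Set.range fun p : ℚ × ℚ => pairTerm p.1 p.2),
      ∀ i ∈ T, w' i = w i := by
  classical
  let T' := T.filter (· ≠ .z)
  let res : (XiIndex → ℚ) →ₗ[ℚ] (T' → ℚ) := LinearMap.funLeft ℚ ℚ Subtype.val
  have htop : (Submodule.span ℚ (Set.range fun p : ℚ × ℚ => pairTerm p.1 p.2)).map res = ⊤ := by
    by_contra hne
    obtain ⟨f, hf, hle⟩ := Submodule.exists_le_ker_of_lt_top _ (lt_top_iff_ne_top.2 hne)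
    refine hf (LinearMap.ext fun y => ?_)
    let c : XiIndex → ℚ := fun i => if hi : i ∈ T' then f (Pi.single ⟨i, hi⟩ 1) else 0
    have hfy : ∀ y : XiIndex → ℚ, f (res y) = ∑ i ∈ T', c i * y i := by
      intro y
      rw [LinearMap.pi_apply_eq_sum_univ f, ← Finset.sum_coe_sort T']
      refine Finset.sum_congr rfl fun i _ => ?_
      rw [smul_eq_mul, mul_comm]
      have hc : c i = f fun j => if i = j then 1 else 0 :=
        (dif_pos i.2).trans (congrArg f (funext fun j => by simp [Pi.single_apply, eq_comm]))
      rw [hc]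
      rfl
    have hc : ∀ i ∈ T', c i = 0 := fun i hi => by
      refine eq_zero_of_sum_mul_pairTerm (T := T') (fun x y => ?_) hi (Finset.mem_filter.1 hi).2
      rw [← hfy]
      exact hle (Submodule.mem_map_of_mem (Submodule.subset_span ⟨(x, y), rfl⟩))
    obtain ⟨y, rfl⟩ : ∃ y', res y' = y :=
      LinearMap.funLeft_surjective_of_injective ℚ ℚ _ Subtype.val_injective y
    rw [hfy, Finset.sum_eq_zero fun i hi => by rw [hc i hi, zero_mul]]
    rfl
  obtain ⟨w', hw', h⟩ : res w ∈
      (Submodule.span ℚ (Set.range fun p : ℚ × ℚ => pairTerm p.1 p.2)).map res := by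
    rw [htop]; trivial
  refine ⟨w', hw', fun i hi => ?_⟩
  by_cases hz : i = .z
  · subst hz
    rw [hw]
    have : Submodule.span ℚ (Set.range fun p : ℚ × ℚ => pairTerm p.1 p.2) ≤
        LinearMap.ker (LinearMap.proj (R := ℚ) (φ := fun _ : XiIndex => ℚ) .z) := by
      rw [Submodule.span_le]
      rintro _ ⟨p, rfl⟩
      simp [pairTerm, colorTerm]
    exact this hw'
  · exact congrFun h ⟨i, Finset.mem_filter.2 ⟨hi, hz⟩⟩

/-- The elements `ξ_n`, `q_{a,b}` and `z` are algebraically independent. -/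
theorem algebraicIndependent_xiBasis : AlgebraicIndependent ℚ xiBasis := by
  rw [algebraicIndependent_iff]
  intro F hF
  refine MvPolynomial.funext fun u => ?_
  rw [map_zero]
  -- the color `0` accounts for the `z`-coordinate, the pairs of colors for all others
  let b : XiIndex → ℚ := genValue {0} fun _ => -u .z
  obtain ⟨w, hw, hwu⟩ := exists_mem_span_pairTerm F.vars (w := u - b) (by simp [b, genValue])
  have h := eval_add_eq_zero_of_mem_span (F := F) hw b (fun d hd => by
    obtain ⟨s, α, hs, h0, hα⟩ := exists_genValue (-u .z) hd
    rw [← hα]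
    exact aeval_genValue_eq_zero hF hs h0 α) 0 (zero_mem _)
  rw [← h]
  refine MvPolynomial.eval₂Hom_congr' rfl (fun i hi _ => ?_) rfl
  simp [hwu i hi]

end Independence

/-! ### The expansion theorem -/

/-- The chromatic `B`-symmetric function of a finite signed graph is, in exactly one way, a
polynomial in the elements `ξ_n`, `q_{a,b}`, `z`, and in this expression the coefficients of the
monomials whose `ξ`-indices sum to `k` add up to the number of acyclic orientations with `k`
sinks. -/
theorem theorem3p4 {V E : Type*} [Fintype V] [Fintype E] (G : SignedGraph V E) :
    (∃! f : MvPolynomial XiIndex ℚ, MvPolynomial.aeval xiBasis f = G.chromaticB) ∧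
    ∀ f : MvPolynomial XiIndex ℚ, MvPolynomial.aeval xiBasis f = G.chromaticB →
      ∀ k : ℕ, ∑ m ∈ f.support with xiIndexSum m = k, f.coeff m = (G.acyclicCount k : ℚ) := by
  obtain ⟨f₀, hf₀, hsink⟩ := G.exists_expansion
  have huniq : ∀ f, MvPolynomial.aeval xiBasis f = G.chromaticB → f = f₀ := fun f hf =>
    algebraicIndependent_xiBasis (hf.trans hf₀.symm)
  refine ⟨⟨f₀, hf₀, huniq⟩, fun f hf k => ?_⟩
  rw [huniq f hf, ← coeff_sinkWeight, hsink, G.coeff_sum_sinks]
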